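/- Let $X,U,Y$ be (real or complex) Banach spaces, let $A$ generate a $C_0$-semigroup $(T(t))_{t\ge 0}$ on $X$, and assume that the dual semigroup $(T'(t))_{t\ge0}$ on $X'$ is also strongly continuous; its generator is $A'$. Let $X_1$ be $D(A)$ with the graph norm, let $X_{-1}$ be the completion of $X$ in the norm $\|(\beta-A)^{-1}x\|_X$ for some $\beta\in\rho(A)$, and let $T_{-1}(t)$ be the continuous extension of $T(t)$ to $X_{-1}$; let $X_1^d$ and $X_{-1}^d$ be the corresponding spaces for $A'$ on $X'$. The pairing of $X'$ and $X$ induces pairings of $X_{-1}^d$ with $X_1$ and of $X_1^d$ with $X_{-1}$. The dual of $B\in\mathcal L(U,X_{-1})$ is the operator $B'\in\mathcal L(X_1^d,U')$ with $\langle B'f,u\rangle=\langle f,Bu\rangle$. Let $\Phi$ be a Young function, i.e. a strictly increasing, continuous, convex function $(0,\infty)\to(0,\infty)$ with $\Phi(t)/t\to0$ as $t\to0$ and $\Phi(t)/t\to\infty$ as $t\to\infty$, extended by $\Phi(0)=0$, and let $\widetilde\Phi(s)=\sup_{t\ge0}(st-\Phi(t))$ be its complementary function. On $L_\Phi(0,\tau;E)$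 consider the Luxemburg norm $\|f\|_{\Phi}=\inf\{k>0:\int_0^\tau\Phi(\|f(t)\|/k)\,dt\le1\}$ and the Orlicz norm $|||f|||_{\Phi}=\sup\{\int_0^\tau|\langle f,g\rangle|\,dt:\ \|g\|_{L_{\widetilde\Phi}(0,\tau;E')}\le1\}$. For $C\in\mathcal L(X_1,Y)$ and $0<\tau<\infty$ let $c^{\Phi}_\tau(C)\in[0,\infty]$ be the least $c$ with $\|CT(\cdot)x\|_{\Phi}\le c\|x\|_X$ for all $x\in D(A)$. For $B\in\mathcal L(U,X_{-1})$ let $b^{\Phi}_\tau(B)\in[0,\infty]$ be the least $b$ such that, for all $u\in L_\Phi(0,\tau;U)$, the integral $\int_0^\tau T_{-1}(\tau-s)Bu(s)\,ds$ lies in $X$ and has norm at most $b\|u\|_{\Phi}$ in $X$ (the value is $\infty$ if there is no finite such constant). Let $\hat c^{\,\Phi}_\tau(C)$ and $\hat b^{\Phi}_\tau(B)$ be the same constants with $|||\cdot|||_\Phi$ in place of $\|\cdot\|_\Phi$, and write $c_\infty=\sup_{\tau>0} c_\tau$, $b_\infty=\sup_{\tau>0} b_\tau$, and likewise for $\hat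 c,\hat b$. The operator $C$ (resp. $B$) is $L_\Phi$-admissible if $c^\Phi_\tau(C)<\infty$ (resp. $b^\Phi_\tau(B)<\infty$) for some $\tau>0$, and infinite-time $L_\Phi$-admissible if in addition $c^\Phi_\infty(C)<\infty$ (resp. $b^\Phi_\infty(B)<\infty$). For $C'$ and $B'$ these notions refer to the semigroup $T'$ on $X'$. 1. For every $C\in\mathcal L(X_1,Y)$ there is a unique $C'\in\mathcal L(Y',X_{-1}^d)$ with $\langle C'g,x\rangle=\langle g,Cx\rangle$ for all $g\in Y'$, $x\in X_1$. The observation operator $C$ is (infinite-time) $L_\Phi$-admissible if and only if the control operator $C'$ is (infinite-time) $L_{\widetilde\Phi}$-admissible. The admissibility constants coincide when they are taken with respect to mutually dual norms: $\hat c^{\,\Phi}_\tau(C)=b^{\widetilde\Phi}_\tau(C')$ and $c^{\Phi}_\tau(C)=\hat b^{\widetilde\Phi}_\tau(C')$ for all $0<\tau\le\infty$. For the Luxemburg norm on both sides, $c^\Phi_\tau(C)\le b^{\widetilde\Phi}_\tau(C')\le 2c^\Phi_\tau(C)$. 2. If the control operator $B\in\mathcal L(U,X_{-1})$ is (infinite-time)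 $L_\Phi$-admissible, then $B'\in\mathcal L(X_1^d,U')$ is an (infinite-time) $L_{\widetilde\Phi}$-admissible observation operator, and $c^{\widetilde\Phi}_\tau(B')\le b^\Phi_\tau(B)$ for all $0<\tau\le\infty$. If $X$ is reflexive, or if $\Phi$ satisfies the $\Delta_2$-condition near infinity (there are $K,t_0\ge0$ with $\Phi(2t)\le K\Phi(t)$ for all $t\ge t_0$), then conversely (infinite-time) $L_{\widetilde\Phi}$-admissibility of $B'$ implies (infinite-time) $L_\Phi$-admissibility of $B$, and the constants coincide with respect to mutually dual norms: $\hat c^{\,\widetilde\Phi}_\tau(B')=b^\Phi_\tau(B)$ and $c^{\widetilde\Phi}_\tau(B')=\hat b^\Phi_\tau(B)$ for all $0<\tau\le\infty$; for the Luxemburg norms, $b^\Phi_\tau(B)\le 2c^{\widetilde\Phi}_\tau(B')$. No reflexivity of $U$ is needed. -/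

import Mathlib

open MeasureTheory Filter Topology Set
open scoped NNReal ENNReal

noncomputable section

/-! ### Young functions and Orlicz spaces -/

/-- `Φ` is a Young function on `[0, ∞)`, with `Φ 0 = 0`; its values on `(-∞, 0)` play no role. -/
structure IsYoungFunction (Φ : ℝ → ℝ) : Prop where
  map_zero : Φ 0 = 0
  pos : ∀ t, 0 < t → 0 < Φ t
  strictMonoOn : StrictMonoOn Φ (Ici 0)
  continuousOn : ContinuousOn Φ (Ici 0)
  convexOn : ConvexOn ℝ (Ici 0) Φ
  tendsto_zero : Tendsto (fun t => Φ t / t) (𝓝[>] 0) (𝓝 0)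
  tendsto_top : Tendsto (fun t => Φ t / t) atTop atTop

/-- The complementary function `s ↦ sup_{t ≥ 0} (s t - Φ t)` (the supremum is finite for a Young
function `Φ`). -/
def complementaryYoung (Φ : ℝ → ℝ) (s : ℝ) : ℝ :=
  sSup ((fun t => s * t - Φ t) '' Ici 0)

/-- The `Δ₂`-condition near infinity. -/
def DeltaTwoInfinity (Φ : ℝ → ℝ) : Prop :=
  ∃ K t₀ : ℝ, 0 ≤ K ∧ 0 ≤ t₀ ∧ ∀ t, t₀ ≤ t → Φ (2 * t) ≤ K * Φ t

section Orlicz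

variable {Ω : Type*} [MeasurableSpace Ω]

/-- The modular `∫ Φ(‖f‖ / k) dμ`. -/
def orliczModular {E : Type*} [NormedAddCommGroup E] (Φ : ℝ → ℝ) (μ : Measure Ω) (k : ℝ)
    (f : Ω → E) : ℝ≥0∞ :=
  ∫⁻ ω, ENNReal.ofReal (Φ (‖f ω‖ / k)) ∂μ

/-- `f` is (a representative of) an element of the Orlicz space `L_Φ(μ; E)`. -/
def MemOrlicz {E : Type*} [NormedAddCommGroup E] (Φ : ℝ → ℝ) (μ : Measure Ω) (f : Ω → E) : Prop :=
  AEStronglyMeasurable f μ ∧ ∃ k : ℝ, 0 < k ∧ orliczModular Φ μ k f < ∞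

/-- The Luxemburg norm, with value `∞` outside `L_Φ`. -/
def luxemburgNorm {E : Type*} [NormedAddCommGroup E] (Φ : ℝ → ℝ) (μ : Measure Ω) (f : Ω → E) :
    ℝ≥0∞ :=
  ⨅ (k : ℝ) (_ : 0 < k) (_ : orliczModular Φ μ k f ≤ 1), ENNReal.ofReal k

/-- The Orlicz norm: the supremum of `∫ |⟨f, g⟩| dμ` over all `E'`-valued `g` whose Luxemburg norm
with respect to the complementary function is at most `1`. -/
def orliczNorm (𝕜 : Type*) [RCLike 𝕜] {E : Type*} [NormedAddCommGroup E] [NormedSpace 𝕜 E]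
    (Φ : ℝ → ℝ) (μ : Measure Ω) (f : Ω → E) : ℝ≥0∞ :=
  ⨆ (g : Ω → StrongDual 𝕜 E) (_ : AEStronglyMeasurable g μ)
    (_ : luxemburgNorm (complementaryYoung Φ) μ g ≤ 1), ∫⁻ ω, ‖g ω (f ω)‖ₑ ∂μ

end Orlicz

/-- Lebesgue measure on the interval `(0, τ)`. -/
def lebesgueUpTo (τ : ℝ) : Measure ℝ := volume.restrict (Ioo 0 τ)

/-! ### Strongly continuous semigroups and their generators -/

/-- A `C₀`-semigroup of bounded operators on `X`. -/
structure C0Semigroup (𝕜 : Type*) [RCLike 𝕜] (X : Type*) [NormedAddCommGroup X]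
    [NormedSpace 𝕜 X] where
  toFun : ℝ≥0 → X →L[𝕜] X
  map_zero : toFun 0 = ContinuousLinearMap.id 𝕜 X
  map_add : ∀ s t, toFun (s + t) = (toFun s).comp (toFun t)
  continuous_orbit : ∀ x, Continuous fun t => toFun t x

namespace C0Semigroup

variable {𝕜 : Type*} [RCLike 𝕜] {X : Type*} [NormedAddCommGroup X] [NormedSpace 𝕜 X]

instance : CoeFun (C0Semigroup 𝕜 X) fun _ => ℝ≥0 → X →L[𝕜] X := ⟨C0Semigroup.toFun⟩

/-- `y` is the right derivative at `0` of the orbit of `x`. -/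
def HasOrbitDeriv (T : C0Semigroup 𝕜 X) (x y : X) : Prop :=
  Tendsto (fun h : ℝ≥0 => (((h : ℝ) : 𝕜)⁻¹) • (T h x - x)) (𝓝[>] 0) (𝓝 y)

theorem HasOrbitDeriv.unique {T : C0Semigroup 𝕜 X} {x y z : X} (hy : T.HasOrbitDeriv x y)
    (hz : T.HasOrbitDeriv x z) : y = z :=
  tendsto_nhds_unique hy hz

theorem HasOrbitDeriv.add {T : C0Semigroup 𝕜 X} {x x' y y' : X} (h : T.HasOrbitDeriv x y)
    (h' : T.HasOrbitDeriv x' y') : T.HasOrbitDeriv (x + x') (y + y') := by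
  refine (Tendsto.add h h').congr fun t => ?_
  rw [← smul_add, (T t).map_add]
  congr 1
  abel

theorem HasOrbitDeriv.smul {T : C0Semigroup 𝕜 X} {x y : X} (c : 𝕜) (h : T.HasOrbitDeriv x y) :
    T.HasOrbitDeriv (c • x) (c • y) := by
  refine (Tendsto.const_smul h c).congr fun t => ?_
  rw [(T t).map_smul, ← smul_sub, smul_comm]

theorem HasOrbitDeriv.map {T : C0Semigroup 𝕜 X} {x y : X} (t : ℝ≥0) (h : T.HasOrbitDeriv x y) :
    T.HasOrbitDeriv (T t x) (T t y) := by
  refine (((T t).continuous.tendsto y).comp h).congr fun s => ?_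
  have hcomm : T t (T s x) = T s (T t x) := by
    rw [← ContinuousLinearMap.comp_apply, ← ContinuousLinearMap.comp_apply, ← T.map_add,
      ← T.map_add, add_comm]
  simp [hcomm]

/-- The domain `D(A)` of the generator. -/
def domain (T : C0Semigroup 𝕜 X) : Submodule 𝕜 X where
  carrier := {x | ∃ y, T.HasOrbitDeriv x y}
  zero_mem' := ⟨0, by simp [HasOrbitDeriv]⟩
  add_mem' := by
    rintro _ _ ⟨y, hy⟩ ⟨z, hz⟩
    exact ⟨y + z, hy.add hz⟩
  smul_mem' := by
    rintro c _ ⟨y, hy⟩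
    exact ⟨c • y, hy.smul c⟩

theorem hasOrbitDeriv_choose (T : C0Semigroup 𝕜 X) (x : T.domain) :
    T.HasOrbitDeriv (x : X) (Classical.choose x.2) :=
  Classical.choose_spec x.2

/-- The generator `A` of the semigroup, as a linear map on its domain. -/
def generator (T : C0Semigroup 𝕜 X) : T.domain →ₗ[𝕜] X where
  toFun x := Classical.choose x.2
  map_add' x y := (T.hasOrbitDeriv_choose (x + y)).unique
    ((T.hasOrbitDeriv_choose x).add (T.hasOrbitDeriv_choose y))
  map_smul' c x := (T.hasOrbitDeriv_choose (c • x)).unique ((T.hasOrbitDeriv_choose x).smul c)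

theorem hasOrbitDeriv_generator (T : C0Semigroup 𝕜 X) (x : T.domain) :
    T.HasOrbitDeriv (x : X) (T.generator x) :=
  T.hasOrbitDeriv_choose x

theorem apply_mem_domain (T : C0Semigroup 𝕜 X) (t : ℝ≥0) {x : X} (hx : x ∈ T.domain) :
    T t x ∈ T.domain :=
  ⟨T t (T.generator ⟨x, hx⟩), (T.hasOrbitDeriv_generator ⟨x, hx⟩).map t⟩

theorem generator_apply_comm (T : C0Semigroup 𝕜 X) (t : ℝ≥0) (x : T.domain) :
    T.generator ⟨T t x, T.apply_mem_domain t x.2⟩ = T t (T.generator x) :=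
  (T.hasOrbitDeriv_generator _).unique ((T.hasOrbitDeriv_generator x).map t)

/-! ### The space `X₁` -/

/-- `X₁`: the domain `D(A)` with the graph norm `‖x‖ + ‖A x‖`. -/
def DomSpace (T : C0Semigroup 𝕜 X) : Type _ := T.domain

namespace DomSpace

variable {T : C0Semigroup 𝕜 X}

instance : AddCommGroup T.DomSpace := inferInstanceAs (AddCommGroup T.domain)

instance : Module 𝕜 T.DomSpace := inferInstanceAs (Module 𝕜 T.domain)

/-- The map `x ↦ (x, A x)` into the `ℓ¹`-sum `X × X`, which induces the graph norm. -/
def toGraph (T : C0Semigroup 𝕜 X) : T.DomSpace →ₗ[𝕜] WithLp 1 (X × X) :=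
  (WithLp.linearEquiv 1 𝕜 (X × X)).symm.toLinearMap ∘ₗ
    (LinearMap.prod T.domain.subtype T.generator : T.domain →ₗ[𝕜] X × X)

theorem toGraph_injective : Function.Injective (toGraph T) := by
  intro x y h
  have h' := (WithLp.linearEquiv 1 𝕜 (X × X)).symm.injective h
  exact Subtype.ext (congrArg Prod.fst h')

instance : NormedAddCommGroup T.DomSpace :=
  NormedAddCommGroup.induced T.DomSpace (WithLp 1 (X × X)) (toGraph T) toGraph_injective

instance : NormedSpace 𝕜 T.DomSpace :=
  NormedSpace.induced 𝕜 T.DomSpace (WithLp 1 (X × X)) (toGraph T)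

/-- The inclusion `X₁ → X`, as a linear map. -/
def valₗ (T : C0Semigroup 𝕜 X) : T.DomSpace →ₗ[𝕜] X := T.domain.subtype

/-- The generator, as a linear map on `X₁`. -/
def genₗ (T : C0Semigroup 𝕜 X) : T.DomSpace →ₗ[𝕜] X := T.generator

theorem norm_def (x : T.DomSpace) : ‖x‖ = ‖valₗ T x‖ + ‖genₗ T x‖ :=
  WithLp.prod_norm_eq_of_L1 (toGraph T x)

/-- The inclusion `X₁ → X`. -/
def val (T : C0Semigroup 𝕜 X) : T.DomSpace →L[𝕜] X :=
  (valₗ T).mkContinuous 1 fun x => by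
    rw [norm_def, one_mul]; exact le_add_of_nonneg_right (norm_nonneg _)

/-- The generator, as a bounded operator `X₁ → X`. -/
def gen (T : C0Semigroup 𝕜 X) : T.DomSpace →L[𝕜] X :=
  (genₗ T).mkContinuous 1 fun x => by
    rw [norm_def, one_mul]; exact le_add_of_nonneg_left (norm_nonneg _)

/-- The operator `β - A : X₁ → X`. -/
def shift (T : C0Semigroup 𝕜 X) (β : 𝕜) : T.DomSpace →L[𝕜] X := β • val T - gen T

/-- The restriction of `T(t)` to `X₁`. -/
def evolve (t : ℝ≥0) (x : T.DomSpace) : T.DomSpace :=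
  (⟨T t (val T x), T.apply_mem_domain t x.2⟩ : T.domain)

theorem gen_evolve (t : ℝ≥0) (x : T.DomSpace) : gen T (evolve t x) = T t (gen T x) :=
  T.generator_apply_comm t x

theorem shift_evolve (β : 𝕜) (t : ℝ≥0) (x : T.DomSpace) :
    shift T β (evolve t x) = T t (shift T β x) := by
  have h : val T (evolve t x) = T t (val T x) := rfl
  simp only [shift, sub_apply, smul_apply, map_sub, map_smul, gen_evolve, h]

end DomSpace

/-! ### Resolvents and the extrapolation space `X₋₁` -/

/-- `R` is a bounded two-sided inverse of `β - A`. -/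
def IsResolvent (T : C0Semigroup 𝕜 X) (β : 𝕜) (R : X →L[𝕜] X) : Prop :=
  (∀ x : X, ∃ z : T.DomSpace, DomSpace.val T z = R x ∧ DomSpace.shift T β z = x) ∧
    ∀ z : T.DomSpace, R (DomSpace.shift T β z) = DomSpace.val T z

/-- The resolvent set `ρ(A)`. -/
def resolventSet (T : C0Semigroup 𝕜 X) : Set 𝕜 := {β | ∃ R, T.IsResolvent β R}

variable (T : C0Semigroup 𝕜 X) {β : 𝕜} (hβ : β ∈ T.resolventSet)

/-- The resolvent `(β - A)⁻¹`. -/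
def resolventOp : X →L[𝕜] X := Classical.choose hβ

theorem isResolvent_resolventOp : T.IsResolvent β (T.resolventOp hβ) :=
  Classical.choose_spec hβ

theorem resolventOp_injective : Function.Injective (T.resolventOp hβ) := by
  intro x y h
  obtain ⟨z, hz, rfl⟩ := (T.isResolvent_resolventOp hβ).1 x
  obtain ⟨w, hw, rfl⟩ := (T.isResolvent_resolventOp hβ).1 y
  have : z = w := Subtype.ext (hz.trans (h.trans hw.symm))
  rw [this]

theorem resolventOp_comm (t : ℝ≥0) (x : X) :
    T.resolventOp hβ (T t x) = T t (T.resolventOp hβ x) := by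
  obtain ⟨z, hz, rfl⟩ := (T.isResolvent_resolventOp hβ).1 x
  rw [← DomSpace.shift_evolve, (T.isResolvent_resolventOp hβ).2, ← hz]
  rfl

/-- The vector space `X`, to be normed by `x ↦ ‖(β - A)⁻¹ x‖`. -/
def ExtrapCore {T : C0Semigroup 𝕜 X} {β : 𝕜} (_ : β ∈ T.resolventSet) : Type _ := X

instance : AddCommGroup (ExtrapCore hβ) := inferInstanceAs (AddCommGroup X)

instance : Module 𝕜 (ExtrapCore hβ) := inferInstanceAs (Module 𝕜 X)

/-- The resolvent on `ExtrapCore`. -/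
def coreResolvent : ExtrapCore hβ →ₗ[𝕜] X := (T.resolventOp hβ).toLinearMap

instance : NormedAddCommGroup (ExtrapCore hβ) :=
  NormedAddCommGroup.induced (ExtrapCore hβ) X (coreResolvent T hβ) (T.resolventOp_injective hβ)

instance : NormedSpace 𝕜 (ExtrapCore hβ) :=
  NormedSpace.induced 𝕜 (ExtrapCore hβ) X (coreResolvent T hβ)

/-- `X₋₁`: the completion of `X` with respect to the norm `x ↦ ‖(β - A)⁻¹ x‖`. -/
def ExtrapSpace {T : C0Semigroup 𝕜 X} {β : 𝕜} (hβ : β ∈ T.resolventSet) : Type _ :=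
  UniformSpace.Completion (ExtrapCore hβ)

instance : NormedAddCommGroup (ExtrapSpace hβ) :=
  inferInstanceAs (NormedAddCommGroup (UniformSpace.Completion (ExtrapCore hβ)))

instance : NormedSpace 𝕜 (ExtrapSpace hβ) :=
  inferInstanceAs (NormedSpace 𝕜 (UniformSpace.Completion (ExtrapCore hβ)))

instance : CompleteSpace (ExtrapSpace hβ) :=
  inferInstanceAs (CompleteSpace (UniformSpace.Completion (ExtrapCore hβ)))

instance : NormedSpace ℝ (ExtrapSpace hβ) := NormedSpace.restrictScalars ℝ 𝕜 (ExtrapSpace hβ)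

instance : IsScalarTower ℝ 𝕜 (ExtrapSpace hβ) := ⟨fun a b x => by
  change (a • b) • x = (algebraMap ℝ 𝕜 a) • (b • x)
  rw [smul_smul, Algebra.smul_def]⟩

/-- The embedding `X → X₋₁`, as a linear map. -/
def inclₗ : X →ₗ[𝕜] ExtrapSpace hβ :=
  (UniformSpace.Completion.toComplₗᵢ (𝕜 := 𝕜) (E := ExtrapCore hβ)).toLinearMap

theorem norm_inclₗ (x : X) : ‖T.inclₗ hβ x‖ = ‖T.resolventOp hβ x‖ :=
  UniformSpace.Completion.norm_coe (E := ExtrapCore hβ) x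

theorem denseRange_inclₗ : DenseRange (T.inclₗ hβ) :=
  UniformSpace.Completion.denseRange_coe (α := ExtrapCore hβ)

/-- The embedding `X → X₋₁`. -/
def incl : X →L[𝕜] ExtrapSpace hβ :=
  (T.inclₗ hβ).mkContinuous ‖T.resolventOp hβ‖ fun x => by
    rw [norm_inclₗ]; exact (T.resolventOp hβ).le_opNorm x

/-- `T₋₁(t)`: the continuous extension of `T(t)` to `X₋₁`. -/
def extrap (t : ℝ≥0) : ExtrapSpace hβ →L[𝕜] ExtrapSpace hβ :=
  (T.inclₗ hβ ∘ₗ (T t).toLinearMap).extendOfNorm (T.inclₗ hβ)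

theorem extrap_incl (t : ℝ≥0) (x : X) : T.extrap hβ t (T.incl hβ x) = T.incl hβ (T t x) :=
  LinearMap.extendOfNorm_eq (T.denseRange_inclₗ hβ) ⟨‖T t‖, fun x => by
    rw [LinearMap.comp_apply, norm_inclₗ, norm_inclₗ]
    change ‖T.resolventOp hβ (T t x)‖ ≤ _
    rw [resolventOp_comm]
    exact (T t).le_opNorm _⟩ x

section

variable [CompleteSpace X]

/-- The continuous extension of the resolvent `(β - A)⁻¹` to an operator `X₋₁ → X`. -/
def resolventExt : ExtrapSpace hβ →L[𝕜] X :=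
  (T.resolventOp hβ).toLinearMap.extendOfNorm (T.inclₗ hβ)

theorem resolventExt_incl (x : X) : T.resolventExt hβ (T.incl hβ x) = T.resolventOp hβ x :=
  LinearMap.extendOfNorm_eq (T.denseRange_inclₗ hβ)
    ⟨1, fun x => by rw [norm_inclₗ, one_mul]; rfl⟩ x

end

/-! ### Duality -/

section Dual

variable {X : Type*} [NormedAddCommGroup X] [NormedSpace 𝕜 X] (T : C0Semigroup 𝕜 X)

/-- The dual semigroup `T'(t) f = f ∘ T(t)` on `X'`, when it is strongly continuous. Its generator
is the adjoint `A'` of the generator `A` of `T`. -/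
def dual (hT : ∀ f : StrongDual 𝕜 X, Continuous fun t : ℝ≥0 => f.comp (T t)) :
    C0Semigroup 𝕜 (StrongDual 𝕜 X) where
  toFun t := ContinuousLinearMap.precomp 𝕜 (T t)
  map_zero := by
    ext f x
    simp [T.map_zero]
  map_add s t := by
    ext f x
    simp [add_comm s t, T.map_add]
  continuous_orbit f := hT f

variable (hT : ∀ f : StrongDual 𝕜 X, Continuous fun t : ℝ≥0 => f.comp (T t))

/-- `⟨A' f, x⟩ = ⟨f, A x⟩` for `f ∈ D(A')` and `x ∈ D(A)`. -/
theorem dual_gen_apply (f : (T.dual hT).DomSpace) (x : T.DomSpace) :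
    DomSpace.gen (T.dual hT) f (DomSpace.val T x) =
      DomSpace.val (T.dual hT) f (DomSpace.gen T x) := by
  have h1 := ((ContinuousLinearMap.apply 𝕜 𝕜 (DomSpace.val T x)).continuous.tendsto _).comp
    ((T.dual hT).hasOrbitDeriv_generator f)
  have h2 := ((DomSpace.val (T.dual hT) f).continuous.tendsto _).comp
    (T.hasOrbitDeriv_generator x)
  refine tendsto_nhds_unique h1 (h2.congr fun t => ?_)
  simp only [Function.comp_apply, map_smul, map_sub]
  rfl

variable {β : 𝕜}

/-- The dual pairing between `X₋₁ᵈ` (the extrapolation space of the dual semigroup) and `X₁`. -/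
def pairExtrapDom (hβ : β ∈ (T.dual hT).resolventSet) :
    ExtrapSpace hβ →L[𝕜] StrongDual 𝕜 T.DomSpace :=
  (ContinuousLinearMap.precomp 𝕜 (DomSpace.shift T β)).comp ((T.dual hT).resolventExt hβ)

/-- The pairing of `X₋₁ᵈ` and `X₁` extends the pairing of `X'` and `X`. -/
theorem pairExtrapDom_incl (hβ : β ∈ (T.dual hT).resolventSet) (f : StrongDual 𝕜 X)
    (x : T.DomSpace) :
    T.pairExtrapDom hT hβ ((T.dual hT).incl hβ f) x = f (DomSpace.val T x) := by
  change (T.dual hT).resolventExt hβ ((T.dual hT).incl hβ f) (DomSpace.shift T β x) = _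
  rw [resolventExt_incl]
  obtain ⟨z, hz, rfl⟩ := ((T.dual hT).isResolvent_resolventOp hβ).1 f
  rw [← hz]
  simp [DomSpace.shift, T.dual_gen_apply hT z x]

variable [CompleteSpace X]

/-- The dual pairing between `X₁ᵈ` (the domain space of the dual semigroup) and `X₋₁`. -/
def pairDomExtrap (hβ : β ∈ T.resolventSet) :
    (T.dual hT).DomSpace →L[𝕜] StrongDual 𝕜 (ExtrapSpace hβ) :=
  (ContinuousLinearMap.precomp 𝕜 (T.resolventExt hβ)).comp (DomSpace.shift (T.dual hT) β)

/-- The pairing of `X₁ᵈ` and `X₋₁` extends the pairing of `X'` and `X`. -/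
theorem pairDomExtrap_incl (hβ : β ∈ T.resolventSet) (f : (T.dual hT).DomSpace) (x : X) :
    T.pairDomExtrap hT hβ f (T.incl hβ x) = DomSpace.val (T.dual hT) f x := by
  change DomSpace.shift (T.dual hT) β f (T.resolventExt hβ (T.incl hβ x)) = _
  rw [resolventExt_incl]
  obtain ⟨z, hz, rfl⟩ := (T.isResolvent_resolventOp hβ).1 x
  rw [← hz]
  simp [DomSpace.shift, T.dual_gen_apply hT f z]

/-- The dual `B' : X₁ᵈ → U'` of a control operator `B : U → X₋₁`, that is
`⟨B' f, u⟩ = ⟨f, B u⟩`. -/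
def dualControl {U : Type*} [NormedAddCommGroup U] [NormedSpace 𝕜 U] (hβ : β ∈ T.resolventSet)
    (B : U →L[𝕜] ExtrapSpace hβ) : (T.dual hT).DomSpace →L[𝕜] StrongDual 𝕜 U :=
  (ContinuousLinearMap.precomp 𝕜 B).comp (T.pairDomExtrap hT hβ)

/-- `C' : Y' → X₋₁ᵈ` is the dual of the observation operator `C : X₁ → Y`, that is
`⟨C' g, x⟩ = ⟨g, C x⟩` for all `g ∈ Y'` and `x ∈ X₁`. -/
def IsDualObservation {Y : Type*} [NormedAddCommGroup Y] [NormedSpace 𝕜 Y]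
    (hβ : β ∈ (T.dual hT).resolventSet) (C : T.DomSpace →L[𝕜] Y)
    (C' : StrongDual 𝕜 Y →L[𝕜] ExtrapSpace hβ) : Prop :=
  ∀ (g : StrongDual 𝕜 Y) (x : T.DomSpace), T.pairExtrapDom hT hβ (C' g) x = g (C x)

end Dual

/-! ### Admissibility -/

section Admissibility

variable {X : Type*} [NormedAddCommGroup X] [NormedSpace 𝕜 X] (T : C0Semigroup 𝕜 X)

/-- The output `t ↦ C T(t) x` of the observation system, for `x ∈ D(A)`. -/
def output {Y : Type*} [NormedAddCommGroup Y] [NormedSpace 𝕜 Y] (C : T.DomSpace →L[𝕜] Y)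
    (x : T.DomSpace) (t : ℝ) : Y :=
  C (DomSpace.evolve t.toNNReal x)

/-- The minimal constant `c` with `N(C T(·) x) ≤ c ‖x‖_X` for all `x ∈ D(A)`, where `N` is a norm
for functions on `(0, τ)`; it is `∞` if there is no finite such constant. -/
def obsConst {Y : Type*} [NormedAddCommGroup Y] [NormedSpace 𝕜 Y] (C : T.DomSpace →L[𝕜] Y)
    (N : Measure ℝ → (ℝ → Y) → ℝ≥0∞) (τ : ℝ) : ℝ≥0∞ :=
  sInf {c | ∀ x : T.DomSpace, N (lebesgueUpTo τ) (T.output C x) ≤ c * ‖DomSpace.val T x‖ₑ}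

/-- The infinite-time observation constant `sup_τ c_τ`. -/
def obsConstInf {Y : Type*} [NormedAddCommGroup Y] [NormedSpace 𝕜 Y] (C : T.DomSpace →L[𝕜] Y)
    (N : Measure ℝ → (ℝ → Y) → ℝ≥0∞) : ℝ≥0∞ :=
  ⨆ (τ : ℝ) (_ : 0 < τ), T.obsConst C N τ

/-- `L_Φ`-admissibility of an observation operator. -/
def IsAdmissibleObs {Y : Type*} [NormedAddCommGroup Y] [NormedSpace 𝕜 Y] (Φ : ℝ → ℝ)
    (C : T.DomSpace →L[𝕜] Y) : Prop :=
  ∃ τ : ℝ, 0 < τ ∧ T.obsConst C (luxemburgNorm Φ) τ < ∞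

/-- Infinite-time `L_Φ`-admissibility of an observation operator. -/
def IsInfAdmissibleObs {Y : Type*} [NormedAddCommGroup Y] [NormedSpace 𝕜 Y] (Φ : ℝ → ℝ)
    (C : T.DomSpace →L[𝕜] Y) : Prop :=
  T.IsAdmissibleObs Φ C ∧ T.obsConstInf C (luxemburgNorm Φ) < ∞

variable {β : 𝕜} {hβ : β ∈ T.resolventSet}

/-- `∫₀^τ T₋₁(τ - s) B u(s) ds`, as an element of `X₋₁`. -/
def inputMap {U : Type*} [NormedAddCommGroup U] [NormedSpace 𝕜 U] (B : U →L[𝕜] ExtrapSpace hβ)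
    (τ : ℝ) (u : ℝ → U) : ExtrapSpace hβ :=
  ∫ s, T.extrap hβ (τ - s).toNNReal (B (u s)) ∂(lebesgueUpTo τ)

/-- The minimal constant `b` such that for every `u ∈ L_Φ(0, τ; U)` the vector
`∫₀^τ T₋₁(τ - s) B u(s) ds` belongs to `X` and its norm in `X` is at most `b N(u)`, where `N` is a
norm on `L_Φ(0, τ; U)`; it is `∞` if there is no finite such constant. -/
def ctrlConst {U : Type*} [NormedAddCommGroup U] [NormedSpace 𝕜 U] (B : U →L[𝕜] ExtrapSpace hβ)
    (Φ : ℝ → ℝ) (N : Measure ℝ → (ℝ → U) → ℝ≥0∞) (τ : ℝ) : ℝ≥0∞ :=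
  sInf {b | ∀ u : ℝ → U, MemOrlicz Φ (lebesgueUpTo τ) u →
    ∃ z : X, T.incl hβ z = T.inputMap B τ u ∧ ‖z‖ₑ ≤ b * N (lebesgueUpTo τ) u}

/-- The infinite-time control constant `sup_τ b_τ`. -/
def ctrlConstInf {U : Type*} [NormedAddCommGroup U] [NormedSpace 𝕜 U]
    (B : U →L[𝕜] ExtrapSpace hβ) (Φ : ℝ → ℝ) (N : Measure ℝ → (ℝ → U) → ℝ≥0∞) : ℝ≥0∞ :=
  ⨆ (τ : ℝ) (_ : 0 < τ), T.ctrlConst B Φ N τ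

/-- `L_Φ`-admissibility of a control operator. -/
def IsAdmissibleCtrl {U : Type*} [NormedAddCommGroup U] [NormedSpace 𝕜 U] (Φ : ℝ → ℝ)
    (B : U →L[𝕜] ExtrapSpace hβ) : Prop :=
  ∃ τ : ℝ, 0 < τ ∧ T.ctrlConst B Φ (luxemburgNorm Φ) τ < ∞

/-- Infinite-time `L_Φ`-admissibility of a control operator. -/
def IsInfAdmissibleCtrl {U : Type*} [NormedAddCommGroup U] [NormedSpace 𝕜 U] (Φ : ℝ → ℝ)
    (B : U →L[𝕜] ExtrapSpace hβ) : Prop :=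
  T.IsAdmissibleCtrl Φ B ∧ T.ctrlConstInf B Φ (luxemburgNorm Φ) < ∞

end Admissibility

end C0Semigroup

end

/-!
The output `s ↦ C T(s) x` and the state `∫₀^τ T'₋₁(τ - s) C' u(s) ds` are linked by the identity
`⟨∫₀^τ T'₋₁(τ - s) C' u(s) ds, x⟩ = ∫₀^τ ⟨u(s), C T(τ - s) x⟩ ds` for `x ∈ X₁`
(`C0Semigroup.pairExtrapDom_inputMap`), and there is a similar identity for `B` and `B'`
(`C0Semigroup.pairDomExtrap_inputMap`). Admissibility of an observation operator bounds a norm of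
the output by `c ‖x‖`; admissibility of a control operator bounds the state, that is, its pairing
with `x`, by a constant times a norm of the input. The constants agree because a norm of a
(time-reversed) output equals the norm of the functional `u ↦ ∫ ⟨u, F⟩` on the inputs.

Norm duality. For a bounded measurable `F` with values in a dual space `V'`, the functional
`u ↦ ∫ ⟨F, u⟩` on `L_Φ(V)` has norm `|||F|||` (complementary function) if `L_Φ(V)` carries the
Luxemburg norm, and norm `‖F‖` (complementary function) if it carries the Orlicz norm:
`IsYoungFunction.orliczNorm_le_iff` and `IsYoungFunction.luxemburgNorm_le_iff`. One direction is
Hölder's inequality. For the other, simple functions that approximate `F` supply `V`-valued `u` with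
`‖u‖ ≤ φ` and `∫ ⟨F, u⟩` close to `∫ φ ‖F‖` (`lintegral_mul_enorm_le_of_forall`), and the scalar
weight `φ` comes from a monotone selection of subgradients, for which Young's inequality is an
equality (`IsYoungFunction.exists_extremal`). Outputs are bounded because they are continuous.
Functions with values in `Y` reduce to this case through the embedding of `Y` in its bidual.

Duality for observation operators. `β - A` and `β - A'` are invertible for the same `β`, and the
resolvent is an isometry of `X₋₁ᵈ` onto `X'`; hence `X₋₁ᵈ` is the dual space of `X₁`, which gives
`C'`. A state in `X₋₁ᵈ` whose pairing with `X₁` is bounded for the norm of `X` extends to a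
functional on `X` of the same norm, because `D(A)` is dense: states lie in `X'` as soon as they are
bounded.

Duality for control operators. The same argument with `A` and `A'` exchanged only places the state
in `X''`. If `X` is reflexive this is enough. Under the `Δ₂`-condition the inputs whose state lies
in `X` form a space that is closed in the Luxemburg norm, as `X` is closed in `X''`. It contains the
indicator inputs of intervals, because integrals of orbits lie in `D(A)`, hence those of all
measurable sets by a Dynkin system argument, and so the simple functions, which are dense
(`C0Semigroup.inputMap_mem_range_of_deltaTwo`).
-/


/-! ### Young functions and their complementary functions -/

namespace IsYoungFunction

variable {Φ : ℝ → ℝ}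

theorem nonneg (hΦ : IsYoungFunction Φ) {t : ℝ} (ht : 0 ≤ t) : 0 ≤ Φ t := by
  rcases ht.eq_or_lt with rfl | h
  · exact hΦ.map_zero.ge
  · exact (hΦ.pos t h).le

theorem mono (hΦ : IsYoungFunction Φ) {s t : ℝ} (hs : 0 ≤ s) (hst : s ≤ t) : Φ s ≤ Φ t :=
  hΦ.strictMonoOn.monotoneOn hs (hs.trans hst) hst

theorem mul_le (hΦ : IsYoungFunction Φ) {a t : ℝ} (ha : 0 ≤ a) (ha1 : a ≤ 1) (ht : 0 ≤ t) :
    Φ (a * t) ≤ a * Φ t := by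
  have h := hΦ.convexOn.2 (x := t) (y := 0) ht self_mem_Ici ha (sub_nonneg.2 ha1)
    (add_sub_cancel _ _)
  simpa [hΦ.map_zero] using h

/-- The supremum defining the complementary function is finite, since `Φ` grows superlinearly. -/
theorem bddAbove (hΦ : IsYoungFunction Φ) (s : ℝ) :
    BddAbove ((fun t => s * t - Φ t) '' Ici 0) := by
  obtain ⟨a, ha⟩ := (hΦ.tendsto_top.eventually_ge_atTop s).exists_forall_of_atTop
  have hb : 0 ≤ max a 1 := le_max_of_le_right zero_le_one
  refine ⟨|s| * max a 1, ?_⟩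
  rintro _ ⟨t, ht, rfl⟩
  have ht' : 0 ≤ t := ht
  have h1 : 0 ≤ |s| * max a 1 := mul_nonneg (abs_nonneg _) hb
  rcases le_total t (max a 1) with h | h
  · have h2 : s * t ≤ |s| * max a 1 :=
      (mul_le_mul_of_nonneg_right (le_abs_self s) ht').trans
        (mul_le_mul_of_nonneg_left h (abs_nonneg _))
    have := hΦ.nonneg ht'
    dsimp only
    linarith
  · have h0 : 0 < t := zero_lt_one.trans_le ((le_max_right _ _).trans h)
    have := (le_div_iff₀ h0).1 (ha t ((le_max_left _ _).trans h))
    dsimp only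
    linarith

/-- Young's inequality. -/
theorem mul_le_add (hΦ : IsYoungFunction Φ) (s : ℝ) {t : ℝ} (ht : 0 ≤ t) :
    s * t ≤ Φ t + complementaryYoung Φ s := by
  have : s * t - Φ t ≤ complementaryYoung Φ s := le_csSup (hΦ.bddAbove s) ⟨t, ht, rfl⟩
  linarith

theorem _root_.complementaryYoung_le {s c : ℝ} (h : ∀ t, 0 ≤ t → s * t - Φ t ≤ c) :
    complementaryYoung Φ s ≤ c := by
  refine csSup_le ⟨_, 0, self_mem_Ici, rfl⟩ ?_
  rintro _ ⟨t, ht, rfl⟩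
  exact h t ht

theorem complementary_nonneg (hΦ : IsYoungFunction Φ) (s : ℝ) : 0 ≤ complementaryYoung Φ s := by
  have := hΦ.mul_le_add s le_rfl
  rw [hΦ.map_zero] at this
  linarith

/-- A Young function has a nonnegative subgradient at every point of `[0, ∞)`. -/
theorem exists_subgradient (hΦ : IsYoungFunction Φ) {t : ℝ} (ht : 0 ≤ t) :
    ∃ p, 0 ≤ p ∧ ∀ r, 0 ≤ r → Φ t + p * (r - t) ≤ Φ r := by
  rcases ht.eq_or_lt with rfl | h0
  · exact ⟨0, le_rfl, fun r hr => by simpa [hΦ.map_zero] using hΦ.nonneg hr⟩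
  -- the left derivative, as the supremum of the slopes of the chords ending at `t`
  set S : Set ℝ := (fun r => (Φ t - Φ r) / (t - r)) '' Ico 0 t with hS
  have hub : ∀ r, t < r → ∀ y ∈ S, y ≤ (Φ r - Φ t) / (r - t) := by
    rintro r hr _ ⟨q, hq, rfl⟩
    exact hΦ.convexOn.slope_mono_adjacent hq.1 (ht.trans hr.le) hq.2 hr
  have hbdd : BddAbove S := ⟨_, hub (t + 1) (lt_add_one t)⟩
  have hne : S.Nonempty := ⟨_, 0, ⟨le_rfl, h0⟩, rfl⟩
  refine ⟨sSup S, ?_, fun r hr => ?_⟩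
  · refine le_csSup_of_le hbdd ⟨0, ⟨le_rfl, h0⟩, rfl⟩ ?_
    simp only [hΦ.map_zero, sub_zero]
    have := hΦ.nonneg ht
    positivity
  · rcases lt_trichotomy r t with h | rfl | h
    · have h1 : (Φ t - Φ r) / (t - r) ≤ sSup S := le_csSup hbdd ⟨r, ⟨hr, h⟩, rfl⟩
      have := (div_le_iff₀ (sub_pos.2 h)).1 h1
      linarith
    · simp
    · have h1 : sSup S ≤ (Φ r - Φ t) / (r - t) := csSup_le hne (hub r h)
      have := (le_div_iff₀ (sub_pos.2 h)).1 h1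
      linarith

/-- A nondecreasing selection `p` of subgradients of `Φ`; it satisfies Young's inequality with
equality. -/
theorem exists_monotone_subgradient (hΦ : IsYoungFunction Φ) :
    ∃ p : ℝ → ℝ, Monotone p ∧ (∀ t, 0 ≤ p t) ∧
      ∀ t, 0 ≤ t → p t * t = Φ t + complementaryYoung Φ (p t) := by
  choose q hq0 hq using fun t : Ici (0 : ℝ) => hΦ.exists_subgradient t.2
  set p : ℝ → ℝ := fun t => q ⟨max t 0, mem_Ici.2 (le_max_right t 0)⟩
  have hp : ∀ t r : ℝ, 0 ≤ r → Φ (max t 0) + p t * (r - max t 0) ≤ Φ r :=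
    fun t => hq ⟨max t 0, mem_Ici.2 (le_max_right t 0)⟩
  refine ⟨p, fun s t hst => ?_, fun t => hq0 _, fun t ht => ?_⟩
  · -- adding the subgradient inequalities at the two points gives `(p t - p s) * (t - s) ≥ 0`
    rcases (max_le_max_right 0 hst).eq_or_lt with h | h
    · exact (congrArg q (Subtype.ext h)).le
    · have h1 := hp s (max t 0) (le_max_right _ _)
      have h2 := hp t (max s 0) (le_max_right _ _)
      nlinarith
  · have ht' : max t 0 = t := max_eq_left ht
    refine le_antisymm (hΦ.mul_le_add _ ht) ?_
    have : complementaryYoung Φ (p t) ≤ p t * t - Φ t :=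
      complementaryYoung_le fun r hr => by
        have := hp t r hr
        rw [ht'] at this
        linarith
    linarith

/-- The complementary function of a Young function is a Young function. -/
theorem complementary (hΦ : IsYoungFunction Φ) : IsYoungFunction (complementaryYoung Φ) := by
  have hzero : complementaryYoung Φ 0 = 0 :=
    le_antisymm (complementaryYoung_le fun t ht => by simpa using hΦ.nonneg ht)
      (hΦ.complementary_nonneg 0)
  have hconv : ConvexOn ℝ univ (complementaryYoung Φ) := by
    refine ⟨convex_univ, fun x _ y _ a b ha hb hab => complementaryYoung_le fun t ht => ?_⟩
    have h1 := mul_le_mul_of_nonneg_left (hΦ.mul_le_add x ht) ha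
    have h2 := mul_le_mul_of_nonneg_left (hΦ.mul_le_add y ht) hb
    have h3 : a * Φ t + b * Φ t = Φ t := by rw [← add_mul, hab, one_mul]
    simp only [smul_eq_mul]
    linarith
  have hpos : ∀ s, 0 < s → 0 < complementaryYoung Φ s := by
    intro s hs
    obtain ⟨t, ht, h0⟩ := ((hΦ.tendsto_zero.eventually_lt_const hs).and
      (eventually_mem_nhdsWithin)).exists
    have h0 : 0 < t := h0
    have := (div_lt_iff₀ h0).1 ht
    have := hΦ.mul_le_add s h0.le
    linarith
  have hmul : ∀ a t, 0 ≤ a → a ≤ 1 →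
      complementaryYoung Φ (a * t) ≤ a * complementaryYoung Φ t := by
    intro a t ha ha1
    have h := hconv.2 (mem_univ t) (mem_univ 0) ha (sub_nonneg.2 ha1) (add_sub_cancel _ _)
    simpa [hzero] using h
  refine ⟨hzero, hpos, ?_, (hconv.continuousOn isOpen_univ).mono (subset_univ _),
    hconv.subset (subset_univ _) (convex_Ici 0), ?_, ?_⟩
  · -- strict monotonicity follows from convexity, `Φ̃ 0 = 0` and positivity
    intro s hs t ht hst
    have hs : 0 ≤ s := hs
    have ht0 : 0 < t := hs.trans_lt hst
    have h := hmul (s / t) t (by positivity) ((div_le_one ht0).2 hst.le)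
    rw [div_mul_cancel₀ _ ht0.ne'] at h
    exact h.trans_lt (mul_lt_of_lt_one_left (hpos t ht0) ((div_lt_one ht0).2 hst))
  · -- if `s < Φ (ε / 2) / (ε / 2)`, then `s * t ≤ Φ t` for `t ≥ ε / 2`, whence `Φ̃ s ≤ s * ε / 2`
    rw [Metric.tendsto_nhdsWithin_nhds]
    intro ε hε
    have hδ : 0 < Φ (ε / 2) / (ε / 2) := div_pos (hΦ.pos _ (half_pos hε)) (half_pos hε)
    refine ⟨_, hδ, fun {s} hs hsδ => ?_⟩
    have hs : 0 < s := hs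
    rw [Real.dist_eq, sub_zero, abs_of_pos hs] at hsδ
    rw [Real.dist_eq, sub_zero, abs_of_nonneg (div_nonneg (hΦ.complementary_nonneg s) hs.le),
      div_lt_iff₀ hs]
    refine lt_of_le_of_lt (b := ε / 2 * s) (complementaryYoung_le fun t ht => ?_) (by nlinarith)
    rcases le_total t (ε / 2) with h | h
    · have := hΦ.nonneg ht
      nlinarith
    · have ht0 : 0 < t := (half_pos hε).trans_le h
      have h1 := hΦ.mul_le (a := ε / 2 / t) (t := t) (by positivity) ((div_le_one ht0).2 h) ht
      rw [div_mul_cancel₀ _ ht0.ne', div_mul_eq_mul_div, le_div_iff₀ ht0] at h1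
      rw [lt_div_iff₀ (half_pos hε)] at hsδ
      have h2 : s * (ε / 2) * t ≤ ε / 2 * Φ t :=
        (mul_le_mul_of_nonneg_right hsδ.le ht).trans h1
      have h3 : s * t ≤ Φ t := le_of_mul_le_mul_left (by linarith) (half_pos hε)
      have : 0 < ε / 2 * s := by positivity
      linarith
  · -- Young's inequality at `t = |b| + 1` gives `Φ̃ s / s ≥ |b|` once `s ≥ Φ (|b| + 1)`
    refine tendsto_atTop.2 fun b => ?_
    have hb : 0 ≤ |b| + 1 := by positivity
    filter_upwards [eventually_gt_atTop 0, eventually_ge_atTop (Φ (|b| + 1))] with s hs hs'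
    rw [le_div_iff₀ hs]
    have h1 := hΦ.mul_le_add s hb
    nlinarith [le_abs_self b]

/-- A Young function is the complementary function of its complementary function. -/
theorem complementary_complementary (hΦ : IsYoungFunction Φ) {t : ℝ} (ht : 0 ≤ t) :
    complementaryYoung (complementaryYoung Φ) t = Φ t := by
  refine le_antisymm (complementaryYoung_le fun s _ => ?_) ?_
  · have := hΦ.mul_le_add s ht
    linarith
  · obtain ⟨p, -, hp0, hp⟩ := hΦ.exists_monotone_subgradient
    have h1 := hp t ht
    have h2 := hΦ.complementary.mul_le_add t (hp0 t)
    linarith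

end IsYoungFunction

/-! ### Modulars and Luxemburg norms -/

section Luxemburg

variable {Ω : Type*} [MeasurableSpace Ω] {μ : Measure Ω} {Φ Ψ : ℝ → ℝ}
  {E F : Type*} [NormedAddCommGroup E] [NormedAddCommGroup F]

/-- The modular depends only on the values of `Φ` on `[0, ∞)`. -/
theorem orliczModular_congr (h : ∀ t, 0 ≤ t → Φ t = Ψ t) {k : ℝ} (hk : 0 < k) (f : Ω → E) :
    orliczModular Φ μ k f = orliczModular Ψ μ k f := by
  unfold orliczModular
  simp only [h _ (div_nonneg (norm_nonneg (f _)) hk.le)]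

theorem luxemburgNorm_congr (h : ∀ t, 0 ≤ t → Φ t = Ψ t) (f : Ω → E) :
    luxemburgNorm Φ μ f = luxemburgNorm Ψ μ f := by
  unfold luxemburgNorm
  refine iInf_congr fun k => iInf_congr fun hk => ?_
  rw [orliczModular_congr h hk]

theorem luxemburgNorm_le {k : ℝ} (hk : 0 < k) {f : Ω → E} (h : orliczModular Φ μ k f ≤ 1) :
    luxemburgNorm Φ μ f ≤ ENNReal.ofReal k :=
  iInf_le_of_le k (iInf_le_of_le hk (iInf_le _ h))

theorem orliczModular_smul {𝕜 : Type*} [RCLike 𝕜] [NormedSpace 𝕜 E] {k : ℝ} (hk : 0 < k)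
    (f : Ω → E) : orliczModular Φ μ 1 (fun ω => ((k : 𝕜)⁻¹) • f ω) = orliczModular Φ μ k f := by
  unfold orliczModular
  simp [norm_smul, abs_of_pos hk, div_eq_inv_mul]

theorem memOrlicz_of_luxemburgNorm_lt_top {f : Ω → E} (hf : AEStronglyMeasurable f μ)
    (h : luxemburgNorm Φ μ f < ∞) : MemOrlicz Φ μ f := by
  simp only [luxemburgNorm, iInf_lt_iff] at h
  obtain ⟨k, hk, hm, -⟩ := h
  exact ⟨hf, k, hk, hm.trans_lt ENNReal.one_lt_top⟩

namespace IsYoungFunction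

variable (hΦ : IsYoungFunction Φ)
include hΦ

theorem orliczModular_mono {k l : ℝ} (hk : 0 < k) (hkl : k ≤ l) {f : Ω → E} {g : Ω → F}
    (h : ∀ ω, ‖f ω‖ ≤ ‖g ω‖) : orliczModular Φ μ l f ≤ orliczModular Φ μ k g :=
  lintegral_mono fun ω => ENNReal.ofReal_le_ofReal <|
    hΦ.mono (div_nonneg (norm_nonneg _) (hk.le.trans hkl)) <|
      div_le_div₀ (norm_nonneg _) (h ω) hk hkl

theorem luxemburgNorm_mono {f : Ω → E} {g : Ω → F} (h : ∀ ω, ‖f ω‖ ≤ ‖g ω‖) :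
    luxemburgNorm Φ μ f ≤ luxemburgNorm Φ μ g :=
  le_iInf fun _ => le_iInf fun hk => le_iInf fun hm =>
    luxemburgNorm_le hk ((hΦ.orliczModular_mono hk le_rfl h).trans hm)

/-- The unit modular ball contains the open Luxemburg ball; the infimum in the Luxemburg norm is
never needed as a minimum. -/
theorem orliczModular_le_one {k : ℝ} {f : Ω → E} (h : luxemburgNorm Φ μ f < ENNReal.ofReal k) :
    orliczModular Φ μ k f ≤ 1 := by
  simp only [luxemburgNorm, iInf_lt_iff] at h
  obtain ⟨l, hl, hm, hlk⟩ := h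
  exact (hΦ.orliczModular_mono hl (ENNReal.ofReal_lt_ofReal_iff'.1 hlk).1.le
    fun _ => le_rfl).trans hm

/-- `Φ` is arbitrary on `(-∞, 0)`; composing with `max · 0` makes it continuous everywhere. -/
theorem continuous_comp_max : Continuous fun t => Φ (max t 0) :=
  hΦ.continuousOn.comp_continuous (by fun_prop) fun t => le_max_right t 0

theorem aemeasurable_modular {k : ℝ} (hk : 0 < k) {f : Ω → E} (hf : AEStronglyMeasurable f μ) :
    AEMeasurable (fun ω => ENNReal.ofReal (Φ (‖f ω‖ / k))) μ := by
  have h := hΦ.continuous_comp_max.measurable.comp_aemeasurable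
    (hf.norm.aemeasurable.div_const k)
  refine h.ennreal_ofReal.congr (Eventually.of_forall fun ω => ?_)
  simp [max_eq_left (div_nonneg (norm_nonneg (f ω)) hk.le)]

/-- If the modular `m` at `k` is finite, then by convexity the modular at `(1 + m) * k` is at
most `1`. -/
theorem luxemburgNorm_lt_top {f : Ω → E} (hf : MemOrlicz Φ μ f) : luxemburgNorm Φ μ f < ∞ := by
  obtain ⟨-, k, hk, hm⟩ := hf
  set m := (orliczModular Φ μ k f).toReal with hm'
  have hm0 : 0 ≤ m := ENNReal.toReal_nonneg
  refine (luxemburgNorm_le (k := (1 + m) * k) (by positivity) ?_).trans_lt ENNReal.ofReal_lt_top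
  calc orliczModular Φ μ ((1 + m) * k) f
      ≤ ∫⁻ ω, ENNReal.ofReal (1 + m)⁻¹ * ENNReal.ofReal (Φ (‖f ω‖ / k)) ∂μ := by
        refine lintegral_mono fun ω => ?_
        rw [← ENNReal.ofReal_mul (by positivity)]
        refine ENNReal.ofReal_le_ofReal ?_
        convert hΦ.mul_le (a := (1 + m)⁻¹) (t := ‖f ω‖ / k) (by positivity)
          (inv_le_one_of_one_le₀ (by linarith)) (by positivity) using 2
        field_simp
    _ = ENNReal.ofReal (1 + m)⁻¹ * ENNReal.ofReal m := by
        rw [lintegral_const_mul' _ _ ENNReal.ofReal_ne_top, hm', ENNReal.ofReal_toReal hm.ne]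
        rfl
    _ ≤ 1 := by
        rw [← ENNReal.ofReal_mul (by positivity), ENNReal.ofReal_le_one,
          inv_mul_le_iff₀ (by positivity)]
        linarith

theorem memOrlicz_of_bound [IsFiniteMeasure μ] {f : Ω → E} (hf : AEStronglyMeasurable f μ) (M : ℝ)
    (hM : ∀ᵐ ω ∂μ, ‖f ω‖ ≤ M) : MemOrlicz Φ μ f := by
  refine ⟨hf, 1, one_pos, ?_⟩
  calc orliczModular Φ μ 1 f ≤ ∫⁻ _, ENNReal.ofReal (Φ M) ∂μ :=
        lintegral_mono_ae <| hM.mono fun ω hω => ENNReal.ofReal_le_ofReal <| by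
          rw [div_one]; exact hΦ.mono (norm_nonneg _) hω
    _ < ∞ := by
        rw [lintegral_const]
        exact ENNReal.mul_lt_top ENNReal.ofReal_lt_top (measure_lt_top _ _)

/-- `L_Φ ⊆ L¹` on a finite measure space, since `t ≤ c + Φ t` for some `c`. -/
theorem integrable_of_memOrlicz [IsFiniteMeasure μ] {f : Ω → E} (hf : MemOrlicz Φ μ f) :
    Integrable f μ := by
  obtain ⟨hfm, k, hk, hm⟩ := hf
  obtain ⟨a, ha⟩ := (hΦ.tendsto_top.eventually_ge_atTop 1).exists_forall_of_atTop
  have key : ∀ t, 0 ≤ t → t ≤ max a 1 + Φ t := by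
    intro t ht
    rcases le_total t (max a 1) with h | h
    · linarith [hΦ.nonneg ht]
    · have h0 : 0 < t := zero_lt_one.trans_le ((le_max_right _ _).trans h)
      have := (le_div_iff₀ h0).1 (ha t ((le_max_left _ _).trans h))
      linarith [le_max_right a 1]
  refine ⟨hfm, ?_⟩
  have hle : ∀ ω, ‖f ω‖ₑ ≤ ENNReal.ofReal k *
      (ENNReal.ofReal (max a 1) + ENNReal.ofReal (Φ (‖f ω‖ / k))) := by
    intro ω
    have h1 : 0 ≤ ‖f ω‖ / k := by positivity
    rw [← ENNReal.ofReal_add (by positivity) (hΦ.nonneg h1), ← ENNReal.ofReal_mul hk.le,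
      ← ofReal_norm]
    refine ENNReal.ofReal_le_ofReal ?_
    have := mul_le_mul_of_nonneg_left (key _ h1) hk.le
    rwa [mul_div_cancel₀ _ hk.ne'] at this
  refine (lintegral_mono hle).trans_lt ?_
  rw [lintegral_const_mul' _ _ ENNReal.ofReal_ne_top, lintegral_add_left measurable_const,
    lintegral_const]
  exact ENNReal.mul_lt_top ENNReal.ofReal_lt_top (ENNReal.add_lt_top.2
    ⟨ENNReal.mul_lt_top ENNReal.ofReal_lt_top (measure_lt_top _ _), hm⟩)

theorem luxemburgNorm_complementary_complementary (f : Ω → E) :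
    luxemburgNorm (complementaryYoung (complementaryYoung Φ)) μ f = luxemburgNorm Φ μ f :=
  luxemburgNorm_congr (fun _ => hΦ.complementary_complementary) f

end IsYoungFunction

end Luxemburg

/-! ### Orlicz norms and Hölder inequalities -/

section Orlicz

variable {𝕜 : Type*} [RCLike 𝕜] {Ω : Type*} [MeasurableSpace Ω] {μ : Measure Ω} {Φ : ℝ → ℝ}
  {V : Type*} [NormedAddCommGroup V] [NormedSpace 𝕜 V]

theorem lintegral_le_orliczNorm {f : Ω → V} {g : Ω → StrongDual 𝕜 V}
    (hg : AEStronglyMeasurable g μ) (h : luxemburgNorm (complementaryYoung Φ) μ g ≤ 1) :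
    ∫⁻ ω, ‖g ω (f ω)‖ₑ ∂μ ≤ orliczNorm 𝕜 Φ μ f :=
  le_iSup_of_le g (le_iSup_of_le hg (le_iSup_of_le h le_rfl))

set_option maxSynthPendingDepth 4 in
/-- The Orlicz norm does not change when `V` is embedded in its bidual. -/
theorem orliczNorm_inclusionInDoubleDual (hΦ : IsYoungFunction Φ) (f : Ω → V) :
    orliczNorm 𝕜 Φ μ (fun ω => NormedSpace.inclusionInDoubleDual 𝕜 V (f ω)) =
      orliczNorm 𝕜 Φ μ f := by
  apply le_antisymm
  · -- functionals on the bidual are restricted to `V`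
    refine iSup_le fun h => iSup_le fun hh => iSup_le fun h1 => ?_
    let P : StrongDual 𝕜 (StrongDual 𝕜 (StrongDual 𝕜 V)) →L[𝕜] StrongDual 𝕜 V :=
      ContinuousLinearMap.precomp 𝕜 (NormedSpace.inclusionInDoubleDual 𝕜 V)
    have hP : ∀ G, ‖P G‖ ≤ ‖G‖ := fun G =>
      (ContinuousLinearMap.opNorm_comp_le G _).trans <|
        mul_le_of_le_one_right (norm_nonneg _) (NormedSpace.inclusionInDoubleDual_norm_le 𝕜 V)
    exact lintegral_le_orliczNorm (g := fun ω => P (h ω))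
      (P.continuous.comp_aestronglyMeasurable hh)
      ((hΦ.complementary.luxemburgNorm_mono fun ω => hP (h ω)).trans h1)
  · refine iSup_le fun g => iSup_le fun hg => iSup_le fun h1 => ?_
    refine lintegral_le_orliczNorm (μ := μ) (Φ := Φ)
      (f := fun ω => NormedSpace.inclusionInDoubleDual 𝕜 V (f ω))
      (g := fun ω => NormedSpace.inclusionInDoubleDual 𝕜 (StrongDual 𝕜 V) (g ω))
      ((NormedSpace.inclusionInDoubleDual 𝕜 (StrongDual 𝕜 V)).continuous.comp_aestronglyMeasurable
        hg) ?_
    exact (hΦ.complementary.luxemburgNorm_mono fun ω =>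
      NormedSpace.double_dual_bound 𝕜 (StrongDual 𝕜 V) (g ω)).trans h1

/-- Passage to the limit `k ↓ b`, for bounds that hold with every real `k > b`. -/
theorem ENNReal.le_mul_of_forall_ofReal {a b c : ℝ≥0∞} (hb : b ≠ ∞) (hc : c ≠ ∞)
    (h : ∀ k : ℝ, 0 < k → b < ENNReal.ofReal k → a ≤ ENNReal.ofReal k * c) : a ≤ b * c := by
  have h1 : Tendsto (fun k : ℝ => ENNReal.ofReal k * c) (𝓝[>] b.toReal) (𝓝 (b * c)) := by
    have := ENNReal.Tendsto.mul_const (b := c)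
      ((ENNReal.continuous_ofReal.tendsto b.toReal).mono_left
        (nhdsWithin_le_nhds (s := Ioi b.toReal))) (.inr hc)
    rwa [ENNReal.ofReal_toReal hb] at this
  refine ge_of_tendsto h1 ?_
  filter_upwards [self_mem_nhdsWithin] with k hk
  have hk : b.toReal < k := hk
  exact h k (ENNReal.toReal_nonneg.trans_lt hk) ((ENNReal.lt_ofReal_iff_toReal_lt hb).2 hk)

namespace IsYoungFunction

variable (hΦ : IsYoungFunction Φ)
include hΦ

/-- The pointwise Young inequality behind the Hölder inequalities. -/
theorem enorm_apply_le {k l : ℝ} (hk : 0 < k) (hl : 0 < l) (G : StrongDual 𝕜 V) (v : V) :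
    ‖G v‖ₑ ≤ ENNReal.ofReal (l * k) * (ENNReal.ofReal (Φ (‖v‖ / k)) +
      ENNReal.ofReal (complementaryYoung Φ (‖G‖ / l))) := by
  have h1 : 0 ≤ ‖v‖ / k := by positivity
  rw [← ENNReal.ofReal_add (hΦ.nonneg h1) (hΦ.complementary_nonneg _),
    ← ENNReal.ofReal_mul (by positivity), ← ofReal_norm]
  refine ENNReal.ofReal_le_ofReal ((G.le_opNorm v).trans ?_)
  have := mul_le_mul_of_nonneg_left (hΦ.mul_le_add (‖G‖ / l) h1) (mul_pos hl hk).le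
  refine le_trans (le_of_eq ?_) this
  field_simp

/-- The Orlicz norm is at most twice the Luxemburg norm. -/
theorem orliczNorm_le_two_mul {f : Ω → V} (hf : AEStronglyMeasurable f μ) :
    orliczNorm 𝕜 Φ μ f ≤ 2 * luxemburgNorm Φ μ f := by
  refine iSup_le fun g => iSup_le fun hg => iSup_le fun h1 => ?_
  rcases eq_or_ne (luxemburgNorm Φ μ f) ∞ with h0 | h0
  · simp [h0]
  rw [mul_comm]
  refine ENNReal.le_mul_of_forall_ofReal h0 (by simp) fun k hk hfk => ?_
  rw [← one_mul (ENNReal.ofReal k * 2)]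
  refine ENNReal.le_mul_of_forall_ofReal (by simp)
    (ENNReal.mul_ne_top ENNReal.ofReal_ne_top (by simp)) fun l hl hgl => ?_
  have hm := hΦ.orliczModular_le_one hfk
  have hm' := hΦ.complementary.orliczModular_le_one (h1.trans_lt hgl)
  refine (lintegral_mono fun ω => hΦ.enorm_apply_le hk hl (g ω) (f ω)).trans ?_
  rw [lintegral_const_mul' _ _ ENNReal.ofReal_ne_top,
    lintegral_add_left' (hΦ.aemeasurable_modular hk hf), ENNReal.ofReal_mul hl.le, mul_assoc]
  gcongr
  exact (add_le_add hm hm').trans_eq one_add_one_eq_two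

theorem orliczNorm_ne_top_of_memOrlicz {f : Ω → V} (hf : MemOrlicz Φ μ f) :
    orliczNorm 𝕜 Φ μ f ≠ ∞ :=
  ((hΦ.orliczNorm_le_two_mul hf.1).trans_lt
    (ENNReal.mul_lt_top (by simp) (hΦ.luxemburgNorm_lt_top hf))).ne

/-- Hölder's inequality, Luxemburg norm of the functional against Orlicz norm of the vector. -/
theorem lintegral_le_luxemburgNorm_mul_orliczNorm {F : Ω → StrongDual 𝕜 V} {u : Ω → V}
    (hF : AEStronglyMeasurable F μ) (hF' : luxemburgNorm (complementaryYoung Φ) μ F ≠ ∞)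
    (hu' : orliczNorm 𝕜 Φ μ u ≠ ∞) :
    ∫⁻ ω, ‖F ω (u ω)‖ₑ ∂μ ≤
      luxemburgNorm (complementaryYoung Φ) μ F * orliczNorm 𝕜 Φ μ u := by
  refine ENNReal.le_mul_of_forall_ofReal hF' hu' fun k hk hk' => ?_
  have hm := hΦ.complementary.orliczModular_le_one hk'
  have h := lintegral_le_orliczNorm (𝕜 := 𝕜) (Φ := Φ) (f := u)
    (g := fun ω => ((k : 𝕜)⁻¹) • F ω) (hF.const_smul ((k : 𝕜)⁻¹))
    ((luxemburgNorm_le one_pos ((orliczModular_smul hk F).trans_le hm)).trans_eq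
      ENNReal.ofReal_one)
  calc ∫⁻ ω, ‖F ω (u ω)‖ₑ ∂μ
      = ∫⁻ ω, ENNReal.ofReal k * ‖(((k : 𝕜)⁻¹) • F ω) (u ω)‖ₑ ∂μ := by
        refine lintegral_congr fun ω => ?_
        rw [← ofReal_norm, ← ofReal_norm, ← ENNReal.ofReal_mul hk.le]
        simp [abs_of_pos hk, mul_inv_cancel_left₀ hk.ne']
    _ ≤ ENNReal.ofReal k * orliczNorm 𝕜 Φ μ u := by
        rw [lintegral_const_mul' _ _ ENNReal.ofReal_ne_top]
        gcongr

/-- Hölder's inequality, Orlicz norm of the functional against Luxemburg norm of the vector. -/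
theorem lintegral_le_orliczNorm_mul_luxemburgNorm {F : Ω → StrongDual 𝕜 V} {u : Ω → V}
    (hu : AEStronglyMeasurable u μ) (hF' : orliczNorm 𝕜 (complementaryYoung Φ) μ F ≠ ∞)
    (hu' : luxemburgNorm Φ μ u ≠ ∞) :
    ∫⁻ ω, ‖F ω (u ω)‖ₑ ∂μ ≤
      orliczNorm 𝕜 (complementaryYoung Φ) μ F * luxemburgNorm Φ μ u := by
  rw [mul_comm]
  refine ENNReal.le_mul_of_forall_ofReal hu' hF' fun k hk hk' => ?_
  have hm := hΦ.orliczModular_le_one hk'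
  set J := NormedSpace.inclusionInDoubleDual 𝕜 V
  have h := lintegral_le_orliczNorm (𝕜 := 𝕜) (Φ := complementaryYoung Φ) (f := F)
    (g := fun ω => J (((k : 𝕜)⁻¹) • u ω)) (J.continuous.comp_aestronglyMeasurable
      (hu.const_smul ((k : 𝕜)⁻¹))) (by
        rw [hΦ.luxemburgNorm_complementary_complementary]
        refine (hΦ.luxemburgNorm_mono fun ω => NormedSpace.double_dual_bound 𝕜 V _).trans ?_
        exact (luxemburgNorm_le one_pos ((orliczModular_smul hk u).trans_le hm)).trans_eq
          ENNReal.ofReal_one)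
  calc ∫⁻ ω, ‖F ω (u ω)‖ₑ ∂μ
      = ∫⁻ ω, ENNReal.ofReal k * ‖J (((k : 𝕜)⁻¹) • u ω) (F ω)‖ₑ ∂μ := by
        refine lintegral_congr fun ω => ?_
        rw [← ofReal_norm, ← ofReal_norm, ← ENNReal.ofReal_mul hk.le]
        simp [J, abs_of_pos hk, mul_inv_cancel_left₀ hk.ne']
    _ ≤ ENNReal.ofReal k * orliczNorm 𝕜 (complementaryYoung Φ) μ F := by
        rw [lintegral_const_mul' _ _ ENNReal.ofReal_ne_top]
        gcongr

end IsYoungFunction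

end Orlicz

/-! ### Norming functionals measurably -/

section Norming

variable {𝕜 : Type*} [RCLike 𝕜] {Ω : Type*} [MeasurableSpace Ω] {μ : Measure Ω}
  {V : Type*} [NormedAddCommGroup V] [NormedSpace 𝕜 V]

/-- Up to `δ`, the norm of `G` is the real part of its value at a vector of the unit ball. -/
theorem StrongDual.exists_almost_norming (G : StrongDual 𝕜 V) {δ : ℝ} (hδ : 0 < δ) :
    ∃ v : V, ‖v‖ ≤ 1 ∧ ‖G‖ - δ ≤ RCLike.re (G v) := by
  rcases le_or_gt ‖G‖ δ with h | h
  · exact ⟨0, by simp, by simpa using h⟩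
  · obtain ⟨v, hv, hGv⟩ := G.exists_lt_apply_of_lt_opNorm (sub_lt_self ‖G‖ hδ)
    have h0 : ‖G v‖ ≠ 0 := ((sub_pos.2 h).trans hGv).ne'
    refine ⟨((‖G v‖ : 𝕜)⁻¹ * (starRingEnd 𝕜) (G v)) • v, ?_, ?_⟩
    · rw [norm_smul, norm_mul, norm_inv, RCLike.norm_ofReal, abs_norm, RCLike.norm_conj,
        inv_mul_cancel₀ h0, one_mul]
      exact hv.le
    · have : G (((‖G v‖ : 𝕜)⁻¹ * (starRingEnd 𝕜) (G v)) • v) = ((‖G v‖ : ℝ) : 𝕜) := by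
        have h0' : (‖G v‖ : 𝕜) ≠ 0 := by exact_mod_cast h0
        rw [map_smul, smul_eq_mul, mul_assoc, RCLike.conj_mul, sq, inv_mul_cancel_left₀ h0']
      rw [this, RCLike.ofReal_re]
      exact hGv.le

/-- If the functional `u ↦ ∫ ⟨F, u⟩ dμ` is bounded by `B` on all measurable `u` with `‖u‖ ≤ φ`,
then `∫ φ ‖F‖ dμ ≤ B`. The functions `u` are built from simple functions approximating `F`, so no
separability or measurable selection is needed. -/
theorem lintegral_mul_enorm_le_of_forall [IsFiniteMeasure μ] {F : Ω → StrongDual 𝕜 V}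
    (hF : AEStronglyMeasurable F μ) {M : ℝ} (hM : ∀ᵐ ω ∂μ, ‖F ω‖ ≤ M) {φ : Ω → ℝ}
    (hφ : Integrable φ μ) (hφ0 : ∀ ω, 0 ≤ φ ω) {B : ℝ≥0∞}
    (h : ∀ u : Ω → V, AEStronglyMeasurable u μ → (∀ ω, ‖u ω‖ ≤ φ ω) →
      ‖∫ ω, F ω (u ω) ∂μ‖ₑ ≤ B) :
    ∫⁻ ω, ENNReal.ofReal (φ ω) * ‖F ω‖ₑ ∂μ ≤ B := by
  rcases eq_or_ne B ∞ with rfl | hB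
  · exact le_top
  set M' := max M 0
  have hM' : ∀ᵐ ω ∂μ, ‖F ω‖ ≤ M' := hM.mono fun ω hω => hω.trans (le_max_left _ _)
  have hM0 : 0 ≤ M' := le_max_right _ _
  have hG := hF.stronglyMeasurable_mk
  set S := hG.approxBounded M'
  have hSM : ∀ n ω, ‖S n ω‖ ≤ M' := fun n ω => hG.norm_approxBounded_le hM0 n ω
  have hSt : ∀ᵐ ω ∂μ, Tendsto (fun n => S n ω) atTop (𝓝 (F ω)) := by
    have h1 : ∀ᵐ ω ∂μ, ‖hF.mk F ω‖ ≤ M' := by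
      filter_upwards [hF.ae_eq_mk, hM'] with ω hω hω'
      rwa [← hω]
    filter_upwards [hG.tendsto_approxBounded_ae h1, hF.ae_eq_mk] with ω h2 h3
    rwa [h3]
  choose sel hsel1 hsel2 using fun (n : ℕ) (G : StrongDual 𝕜 V) =>
    G.exists_almost_norming (δ := 1 / ((n : ℝ) + 1)) (by positivity)
  set u : ℕ → Ω → V := fun n ω => (φ ω : 𝕜) • (S n).map (sel n) ω with hu
  have humeas : ∀ n, AEStronglyMeasurable (u n) μ := fun n =>
    (RCLike.continuous_ofReal.comp_aestronglyMeasurable hφ.1).smul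
      ((S n).map (sel n)).aestronglyMeasurable
  have hunorm : ∀ n ω, ‖u n ω‖ ≤ φ ω := fun n ω => by
    rw [hu, norm_smul, RCLike.norm_ofReal, abs_of_nonneg (hφ0 ω)]
    exact mul_le_of_le_one_right (hφ0 ω) (hsel1 n _)
  -- pointwise lower bound for the integrand of `u n`
  have hre : ∀ n ω, φ ω * (‖S n ω‖ - 1 / ((n : ℝ) + 1) - ‖F ω - S n ω‖) ≤
      RCLike.re (F ω (u n ω)) := by
    intro n ω
    have h1 := hsel2 n (S n ω)
    have h2 : ‖(F ω - S n ω) (sel n (S n ω))‖ ≤ ‖F ω - S n ω‖ :=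
      ((F ω - S n ω).le_opNorm _).trans (mul_le_of_le_one_right (norm_nonneg _) (hsel1 n _))
    have h3 := (abs_le.1 ((RCLike.abs_re_le_norm _).trans h2)).1
    have h4 : RCLike.re (F ω (u n ω)) = φ ω * RCLike.re (F ω (sel n (S n ω))) := by
      rw [hu]
      simp only [SimpleFunc.map_apply, map_smul, smul_eq_mul, RCLike.re_ofReal_mul]
    rw [h4]
    refine mul_le_mul_of_nonneg_left ?_ (hφ0 ω)
    rw [sub_apply, map_sub] at h3
    linarith
  have hint : ∀ n, Integrable (fun ω => F ω (u n ω)) μ := fun n => by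
    refine (hφ.const_mul M').mono'
      (isBoundedBilinearMap_apply.continuous.comp_aestronglyMeasurable (hF.prodMk (humeas n))) ?_
    filter_upwards [hM'] with ω hω
    exact ((F ω).le_opNorm _).trans (mul_le_mul hω (hunorm n ω) (norm_nonneg _) hM0)
  set low : ℕ → Ω → ℝ := fun n ω => φ ω * (‖S n ω‖ - 1 / ((n : ℝ) + 1) - ‖F ω - S n ω‖)
  have hlowm : ∀ n, AEStronglyMeasurable (low n) μ := fun n =>
    hφ.1.mul (((S n).aestronglyMeasurable.norm.sub aestronglyMeasurable_const).sub
      (hF.sub (S n).aestronglyMeasurable).norm)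
  have hlowb : ∀ n, ∀ᵐ ω ∂μ, ‖low n ω‖ ≤ φ ω * (3 * M' + 1) := fun n => by
    filter_upwards [hM'] with ω h3
    rw [norm_mul, Real.norm_eq_abs, abs_of_nonneg (hφ0 ω)]
    refine mul_le_mul_of_nonneg_left ?_ (hφ0 ω)
    have h1 := hSM n ω
    have h2 := norm_sub_le (F ω) (S n ω)
    have h4 : 1 / ((n : ℝ) + 1) ≤ 1 := by
      rw [div_le_one (by positivity)]
      linarith [n.cast_nonneg (α := ℝ)]
    have h5 : 0 ≤ 1 / ((n : ℝ) + 1) := by positivity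
    have h6 := norm_nonneg (S n ω)
    have h7 := norm_nonneg (F ω - S n ω)
    rw [Real.norm_eq_abs, abs_le]
    constructor <;> linarith
  have hlow : ∀ n, ∫ ω, low n ω ∂μ ≤ B.toReal := fun n => by
    have h1 : ∫ ω, low n ω ∂μ ≤ ∫ ω, RCLike.re (F ω (u n ω)) ∂μ :=
      integral_mono ((hφ.mul_const _).mono' (hlowm n) (hlowb n))
        (hint n).re (hre n)
    rw [integral_re (hint n)] at h1
    refine h1.trans ((RCLike.re_le_norm _).trans ?_)
    rw [← toReal_enorm]
    exact ENNReal.toReal_mono hB (h _ (humeas n) (hunorm n))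
  have hlim : Tendsto (fun n => ∫ ω, low n ω ∂μ) atTop (𝓝 (∫ ω, φ ω * ‖F ω‖ ∂μ)) := by
    refine tendsto_integral_of_dominated_convergence _ hlowm (hφ.mul_const (3 * M' + 1))
      hlowb ?_
    filter_upwards [hSt] with ω hω
    have h1 := (hω.norm.sub tendsto_one_div_add_atTop_nhds_zero_nat).sub
      ((tendsto_const_nhds (x := F ω)).sub hω).norm
    simpa [low] using h1.const_mul (φ ω)
  have hfin : ∫ ω, φ ω * ‖F ω‖ ∂μ ≤ B.toReal := le_of_tendsto' hlim hlow
  have hint' : Integrable (fun ω => φ ω * ‖F ω‖) μ :=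
    (hφ.mul_const M').mono' (hφ.1.mul hF.norm) (hM'.mono fun ω hω => by
      rw [norm_mul, norm_norm, Real.norm_eq_abs, abs_of_nonneg (hφ0 ω)]
      exact mul_le_mul_of_nonneg_left hω (hφ0 ω))
  calc ∫⁻ ω, ENNReal.ofReal (φ ω) * ‖F ω‖ₑ ∂μ = ∫⁻ ω, ENNReal.ofReal (φ ω * ‖F ω‖) ∂μ := by
        refine lintegral_congr fun ω => ?_
        rw [ENNReal.ofReal_mul (hφ0 ω), ofReal_norm]
    _ = ENNReal.ofReal (∫ ω, φ ω * ‖F ω‖ ∂μ) :=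
        (ofReal_integral_eq_lintegral_ofReal hint'
          (Eventually.of_forall fun ω => mul_nonneg (hφ0 ω) (norm_nonneg _))).symm
    _ ≤ B := ENNReal.ofReal_le_of_le_toReal hfin

end Norming

/-! ### Duality of Luxemburg and Orlicz norms -/

namespace IsYoungFunction

section

variable {Ω : Type*} [MeasurableSpace Ω] {μ : Measure Ω} {Φ : ℝ → ℝ}

/-- The extremal function for the scalar norm duality: if `∫ Φ(f) > 1` and `p` selects subgradients
of `Φ`, then `φ = p(f) / (1 + ∫ Φ̃(p(f)))` lies in the unit balls of both norms associated with the
complementary function `Φ̃`, and `∫ f φ > 1` by the equality case of Young's inequality. -/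
theorem exists_extremal [IsFiniteMeasure μ] (hΦ : IsYoungFunction Φ) {f : Ω → ℝ}
    (hf : AEMeasurable f μ) (hf0 : ∀ ω, 0 ≤ f ω) {M : ℝ} (hM : ∀ᵐ ω ∂μ, f ω ≤ M)
    (h1 : 1 < ∫⁻ ω, ENNReal.ofReal (Φ (f ω)) ∂μ) :
    ∃ φ : Ω → ℝ, AEMeasurable φ μ ∧ (∀ ω, 0 ≤ φ ω) ∧ (∃ N, ∀ᵐ ω ∂μ, φ ω ≤ N) ∧
      ∫⁻ ω, ENNReal.ofReal (complementaryYoung Φ (φ ω)) ∂μ ≤ 1 ∧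
      (∀ g : Ω → ℝ, (∀ ω, 0 ≤ g ω) → ∫⁻ ω, ENNReal.ofReal (Φ (g ω)) ∂μ ≤ 1 →
        ∫⁻ ω, ENNReal.ofReal (g ω * φ ω) ∂μ ≤ 1) ∧
      1 < ∫⁻ ω, ENNReal.ofReal (f ω * φ ω) ∂μ := by
  obtain ⟨p, hpm, hp0, hp⟩ := hΦ.exists_monotone_subgradient
  have hΦ' := hΦ.complementary
  have hpf : AEMeasurable (fun ω => p (f ω)) μ := hpm.measurable.comp_aemeasurable hf
  have hmeas' : AEMeasurable
      (fun ω => ENNReal.ofReal (complementaryYoung Φ (p (f ω)))) μ := by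
    have h := hΦ'.continuous_comp_max.measurable.comp_aemeasurable hpf
    refine h.ennreal_ofReal.congr (Eventually.of_forall fun ω => ?_)
    simp [max_eq_left (hp0 (f ω))]
  set m' := ∫⁻ ω, ENNReal.ofReal (complementaryYoung Φ (p (f ω))) ∂μ with hm'
  have hfin : m' < ∞ := by
    refine (lintegral_mono_ae (hM.mono fun ω hω => ENNReal.ofReal_le_ofReal
      (hΦ'.mono (hp0 _) (hpm hω)))).trans_lt ?_
    rw [lintegral_const]
    exact ENNReal.mul_lt_top ENNReal.ofReal_lt_top (measure_lt_top _ _)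
  set m := m'.toReal
  have hm0 : 0 ≤ m := ENNReal.toReal_nonneg
  have hmm : ENNReal.ofReal m = m' := ENNReal.ofReal_toReal hfin.ne
  have hc0 : (0 : ℝ) ≤ (1 + m)⁻¹ := by positivity
  have hc1 : (1 + m)⁻¹ ≤ 1 := inv_le_one_of_one_le₀ (by linarith)
  have hc : ENNReal.ofReal (1 + m)⁻¹ * (1 + m') = 1 := by
    rw [← hmm, ← ENNReal.ofReal_one, ← ENNReal.ofReal_add zero_le_one hm0,
      ← ENNReal.ofReal_mul hc0, inv_mul_cancel₀ (by positivity)]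
  have hsplit : ∀ g : Ω → ℝ, (∀ ω, 0 ≤ g ω) →
      ∫⁻ ω, ENNReal.ofReal (g ω * ((1 + m)⁻¹ * p (f ω))) ∂μ =
        ENNReal.ofReal (1 + m)⁻¹ * ∫⁻ ω, ENNReal.ofReal (p (f ω) * g ω) ∂μ := by
    intro g hg
    rw [← lintegral_const_mul' _ _ ENNReal.ofReal_ne_top]
    refine lintegral_congr fun ω => ?_
    rw [← ENNReal.ofReal_mul hc0]
    congr 1
    ring
  refine ⟨fun ω => (1 + m)⁻¹ * p (f ω), hpf.const_mul _, fun ω => mul_nonneg hc0 (hp0 _),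
    ⟨(1 + m)⁻¹ * p M, hM.mono fun ω hω => mul_le_mul_of_nonneg_left (hpm hω) hc0⟩, ?_, ?_, ?_⟩
  · calc ∫⁻ ω, ENNReal.ofReal (complementaryYoung Φ ((1 + m)⁻¹ * p (f ω))) ∂μ
        ≤ ∫⁻ ω, ENNReal.ofReal (1 + m)⁻¹ *
            ENNReal.ofReal (complementaryYoung Φ (p (f ω))) ∂μ := by
          refine lintegral_mono fun ω => ?_
          rw [← ENNReal.ofReal_mul hc0]
          exact ENNReal.ofReal_le_ofReal (hΦ'.mul_le hc0 hc1 (hp0 _))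
      _ ≤ ENNReal.ofReal (1 + m)⁻¹ * (1 + m') := by
          rw [lintegral_const_mul' _ _ ENNReal.ofReal_ne_top]
          gcongr
          exact le_add_self
      _ = 1 := hc
  · intro g hg hg1
    rw [hsplit g hg, ← hc]
    gcongr
    calc ∫⁻ ω, ENNReal.ofReal (p (f ω) * g ω) ∂μ
        ≤ ∫⁻ ω, (ENNReal.ofReal (Φ (g ω)) +
            ENNReal.ofReal (complementaryYoung Φ (p (f ω)))) ∂μ := by
          refine lintegral_mono fun ω => ?_
          rw [← ENNReal.ofReal_add (hΦ.nonneg (hg ω)) (hΦ.complementary_nonneg _)]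
          exact ENNReal.ofReal_le_ofReal (hΦ.mul_le_add _ (hg ω))
      _ ≤ 1 + m' := by
          rw [lintegral_add_right' _ hmeas']
          gcongr
  · rw [hsplit f hf0, ← hc]
    refine ENNReal.mul_lt_mul_right (by simp; positivity) ENNReal.ofReal_ne_top ?_
    have : ∫⁻ ω, ENNReal.ofReal (p (f ω) * f ω) ∂μ =
        (∫⁻ ω, ENNReal.ofReal (Φ (f ω)) ∂μ) + m' := by
      rw [hm', ← lintegral_add_right' _ hmeas']
      refine lintegral_congr fun ω => ?_
      rw [hp _ (hf0 ω), ENNReal.ofReal_add (hΦ.nonneg (hf0 ω)) (hΦ.complementary_nonneg _)]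
    rw [this]
    exact ENNReal.add_lt_add_right hfin.ne h1

end

section

variable {𝕜 : Type*} [RCLike 𝕜] {Ω : Type*} [MeasurableSpace Ω] {μ : Measure Ω}
  [IsFiniteMeasure μ] {Φ : ℝ → ℝ} {V : Type*} [NormedAddCommGroup V] [NormedSpace 𝕜 V]
  (hΦ : IsYoungFunction Φ) {F : Ω → StrongDual 𝕜 V} (hF : AEStronglyMeasurable F μ)
  (hFb : ∃ M, ∀ᵐ ω ∂μ, ‖F ω‖ ≤ M)
include hΦ hF hFb

/-- The Luxemburg norm of `F` is controlled by the functions `u` in the unit ball of both norms: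
otherwise the extremal function for `‖F‖ / k`, with `B < k < ‖F‖_{Φ̃}`, leads to a contradiction. -/
theorem luxemburgNorm_le_of_forall {B : ℝ≥0∞}
    (h : ∀ u : Ω → V, MemOrlicz Φ μ u → luxemburgNorm Φ μ u ≤ 1 → orliczNorm 𝕜 Φ μ u ≤ 1 →
      ‖∫ ω, F ω (u ω) ∂μ‖ₑ ≤ B) :
    luxemburgNorm (complementaryYoung Φ) μ F ≤ B := by
  obtain ⟨M, hM⟩ := hFb
  rcases eq_or_ne B ∞ with rfl | hB
  · exact le_top
  rw [← mul_one B]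
  refine ENNReal.le_mul_of_forall_ofReal hB (by simp) fun k hk hBk => ?_
  rw [mul_one]
  refine luxemburgNorm_le hk (not_lt.1 fun hlt => ?_)
  obtain ⟨φ, hφm, hφ0, ⟨N, hN⟩, hφ1, hφ2, hφ3⟩ := hΦ.complementary.exists_extremal
    (f := fun ω => ‖F ω‖ / k) (hF.norm.aemeasurable.div_const k) (fun ω => by positivity)
    (M := M / k) (hM.mono fun ω hω => div_le_div_of_nonneg_right hω hk.le) hlt
  have hint : Integrable φ μ :=
    (integrable_const N).mono' hφm.aestronglyMeasurable (hN.mono fun ω hω => by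
      rwa [Real.norm_eq_abs, abs_of_nonneg (hφ0 ω)])
  have key := lintegral_mul_enorm_le_of_forall hF hM hint hφ0 (B := B) fun u hu huφ => by
    have hm : orliczModular Φ μ 1 u ≤ 1 := by
      refine le_trans (lintegral_mono fun ω => ENNReal.ofReal_le_ofReal ?_) hφ1
      rw [hΦ.complementary_complementary (hφ0 ω), div_one]
      exact hΦ.mono (norm_nonneg _) (huφ ω)
    refine h u ⟨hu, 1, one_pos, hm.trans_lt ENNReal.one_lt_top⟩
      ((luxemburgNorm_le one_pos hm).trans_eq ENNReal.ofReal_one) ?_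
    refine iSup_le fun g => iSup_le fun _ => iSup_le fun hg1 => ?_
    rw [← one_mul 1]
    refine ENNReal.le_mul_of_forall_ofReal (by simp) (by simp) fun l hl hl1 => ?_
    have hgl := hφ2 (fun ω => ‖g ω‖ / l) (fun ω => by positivity)
      (hΦ.complementary.orliczModular_le_one (hg1.trans_lt hl1))
    refine le_trans (lintegral_mono fun ω => ?_) ((lintegral_const_mul' _ _
      ENNReal.ofReal_ne_top).trans_le (mul_le_mul_right hgl (ENNReal.ofReal l)))
    rw [← ENNReal.ofReal_mul hl.le, ← ofReal_norm]
    refine ENNReal.ofReal_le_ofReal (((g ω).le_opNorm (u ω)).trans ?_)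
    rw [← mul_assoc, mul_div_cancel₀ _ hl.ne']
    exact mul_le_mul_of_nonneg_left (huφ ω) (norm_nonneg _)
  refine hφ3.not_ge ?_
  calc ∫⁻ ω, ENNReal.ofReal (‖F ω‖ / k * φ ω) ∂μ
      = ENNReal.ofReal k⁻¹ * ∫⁻ ω, ENNReal.ofReal (φ ω) * ‖F ω‖ₑ ∂μ := by
        rw [← lintegral_const_mul' _ _ ENNReal.ofReal_ne_top]
        refine lintegral_congr fun ω => ?_
        rw [← ofReal_norm, ← ENNReal.ofReal_mul (hφ0 ω), ← ENNReal.ofReal_mul (by positivity)]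
        congr 1
        ring
    _ ≤ ENNReal.ofReal k⁻¹ * ENNReal.ofReal k := by
        gcongr
        exact key.trans hBk.le
    _ = 1 := by
        rw [← ENNReal.ofReal_mul (by positivity), inv_mul_cancel₀ hk.ne', ENNReal.ofReal_one]

/-- The Orlicz norm of `F` is controlled by the functions `u` in the Luxemburg unit ball: a test
function `g` with values in the bidual is replaced by `V`-valued functions `u` with
`‖u‖ ≤ ‖g‖`. -/
theorem orliczNorm_le_of_forall {B : ℝ≥0∞}
    (h : ∀ u : Ω → V, MemOrlicz Φ μ u → luxemburgNorm Φ μ u ≤ 1 →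
      ‖∫ ω, F ω (u ω) ∂μ‖ₑ ≤ B) :
    orliczNorm 𝕜 (complementaryYoung Φ) μ F ≤ B := by
  obtain ⟨M, hM⟩ := hFb
  refine iSup_le fun g => iSup_le fun hg => iSup_le fun h1 => ?_
  rw [hΦ.luxemburgNorm_complementary_complementary] at h1
  have hgm : MemOrlicz Φ μ g :=
    memOrlicz_of_luxemburgNorm_lt_top hg (h1.trans_lt ENNReal.one_lt_top)
  refine le_trans (lintegral_mono fun ω => ?_) (lintegral_mul_enorm_le_of_forall hF hM
    (hΦ.integrable_of_memOrlicz hgm).norm (fun ω => norm_nonneg _) fun u hu hug => ?_)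
  · rw [ofReal_norm]
    exact (g ω).le_opENorm (F ω)
  · have hu1 := (hΦ.luxemburgNorm_mono hug).trans h1
    exact h u (memOrlicz_of_luxemburgNorm_lt_top hu (hu1.trans_lt ENNReal.one_lt_top)) hu1

theorem luxemburgNorm_ne_top : luxemburgNorm (complementaryYoung Φ) μ F ≠ ∞ := by
  obtain ⟨M, hM⟩ := hFb
  exact (hΦ.complementary.luxemburgNorm_lt_top
    (hΦ.complementary.memOrlicz_of_bound hF M hM)).ne

theorem orliczNorm_ne_top : orliczNorm 𝕜 (complementaryYoung Φ) μ F ≠ ∞ :=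
  ((hΦ.complementary.orliczNorm_le_two_mul hF).trans_lt
    (ENNReal.mul_lt_top (by simp) (hΦ.luxemburgNorm_ne_top hF hFb).lt_top)).ne

/-- The functional `u ↦ ∫ ⟨F, u⟩` has norm `|||F|||` for the Luxemburg norm on `u`. -/
theorem orliczNorm_le_iff {b : ℝ≥0∞} :
    orliczNorm 𝕜 (complementaryYoung Φ) μ F ≤ b ↔
      ∀ u : Ω → V, MemOrlicz Φ μ u → ‖∫ ω, F ω (u ω) ∂μ‖ₑ ≤ b * luxemburgNorm Φ μ u := by
  refine ⟨fun h u hu => ?_, fun h => hΦ.orliczNorm_le_of_forall hF hFb fun u hu hu1 =>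
    (h u hu).trans (mul_le_of_le_one_right' hu1)⟩
  refine (enorm_integral_le_lintegral_enorm _).trans
    ((hΦ.lintegral_le_orliczNorm_mul_luxemburgNorm hu.1 (hΦ.orliczNorm_ne_top hF hFb)
      (hΦ.luxemburgNorm_lt_top hu).ne).trans ?_)
  gcongr

theorem luxemburgNorm_le_orliczNorm :
    luxemburgNorm (complementaryYoung Φ) μ F ≤ orliczNorm 𝕜 (complementaryYoung Φ) μ F := by
  refine hΦ.luxemburgNorm_le_of_forall hF hFb fun u hu hu1 _ => ?_
  exact ((hΦ.orliczNorm_le_iff hF hFb).1 le_rfl u hu).trans (mul_le_of_le_one_right' hu1)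

/-- The functional `u ↦ ∫ ⟨F, u⟩` has norm `‖F‖` for the Orlicz norm on `u`. -/
theorem luxemburgNorm_le_iff {b : ℝ≥0∞} :
    luxemburgNorm (complementaryYoung Φ) μ F ≤ b ↔
      ∀ u : Ω → V, MemOrlicz Φ μ u → ‖∫ ω, F ω (u ω) ∂μ‖ₑ ≤ b * orliczNorm 𝕜 Φ μ u := by
  refine ⟨fun h u hu => ?_, fun h => hΦ.luxemburgNorm_le_of_forall hF hFb fun u hu _ hu1 =>
    (h u hu).trans (mul_le_of_le_one_right' hu1)⟩
  refine (enorm_integral_le_lintegral_enorm _).trans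
    ((hΦ.lintegral_le_luxemburgNorm_mul_orliczNorm hF (hΦ.luxemburgNorm_ne_top hF hFb)
      (hΦ.orliczNorm_ne_top_of_memOrlicz hu)).trans ?_)
  gcongr

end

end IsYoungFunction

/-! ### Strongly continuous semigroups -/

namespace C0Semigroup

variable {𝕜 : Type*} [RCLike 𝕜] {X : Type*} [NormedAddCommGroup X] [NormedSpace 𝕜 X]

section Basic

variable (T : C0Semigroup 𝕜 X)

theorem apply_zero (x : X) : T 0 x = x := by
  rw [T.map_zero]; rfl

theorem apply_add (s t : ℝ≥0) (x : X) : T (s + t) x = T s (T t x) := by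
  rw [T.map_add]; rfl

/-- A semigroup is bounded on bounded time intervals. -/
theorem exists_norm_le [CompleteSpace X] (τ : ℝ≥0) : ∃ M : ℝ, 0 ≤ M ∧ ∀ t ≤ τ, ‖T t‖ ≤ M := by
  obtain ⟨M, hM⟩ := banach_steinhaus (g := fun t : Iic τ => T t) fun x => by
    obtain ⟨C, hC⟩ := (isCompact_Icc (a := (0 : ℝ≥0)) (b := τ)).exists_bound_of_continuousOn
      (T.continuous_orbit x).continuousOn
    exact ⟨C, fun t => hC t ⟨zero_le, t.2⟩⟩
  exact ⟨M, (norm_nonneg _).trans (hM ⟨τ, mem_Iic.2 le_rfl⟩), fun t ht => hM ⟨t, ht⟩⟩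

/-- Joint strong continuity. -/
theorem continuous_uncurry [CompleteSpace X] : Continuous fun p : ℝ≥0 × X => T p.1 p.2 := by
  refine continuous_iff_continuousAt.2 fun ⟨t₀, x₀⟩ => ?_
  obtain ⟨M, hM0, hM⟩ := T.exists_norm_le (t₀ + 1)
  have h1 : Tendsto (fun p : ℝ≥0 × X => T p.1 (p.2 - x₀)) (𝓝 (t₀, x₀)) (𝓝 0) := by
    have h2 : Tendsto (fun p : ℝ≥0 × X => M * ‖p.2 - x₀‖) (𝓝 (t₀, x₀)) (𝓝 0) := by
      have : Continuous fun p : ℝ≥0 × X => M * ‖p.2 - x₀‖ := by fun_prop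
      simpa using this.tendsto (t₀, x₀)
    refine squeeze_zero_norm' ?_ h2
    have h3 : ∀ᶠ p : ℝ≥0 × X in 𝓝 (t₀, x₀), p.1 < t₀ + 1 :=
      (continuous_fst.tendsto (t₀, x₀)).eventually_lt_const (lt_add_one t₀)
    filter_upwards [h3] with p hp
    exact ((T p.1).le_opNorm _).trans (mul_le_mul_of_nonneg_right (hM _ hp.le) (norm_nonneg _))
  have h4 : Tendsto (fun p : ℝ≥0 × X => T p.1 x₀) (𝓝 (t₀, x₀)) (𝓝 (T t₀ x₀)) :=
    ((T.continuous_orbit x₀).comp continuous_fst).tendsto (t₀, x₀)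
  have h5 := h1.add h4
  rw [zero_add] at h5
  refine h5.congr fun p => ?_
  rw [← _root_.map_add, sub_add_cancel]

variable {T}

theorem hasOrbitDeriv_of_forall {x y : X}
    (h : ∀ ε : ℝ, 0 < ε → ∃ δ : ℝ, 0 < δ ∧ ∀ t : ℝ≥0, (t : ℝ) < δ →
      ‖T t x - x - ((t : ℝ) : 𝕜) • y‖ ≤ ε * t) : T.HasOrbitDeriv x y := by
  refine Metric.tendsto_nhdsWithin_nhds.2 fun ε hε => ?_
  obtain ⟨δ, hδ, H⟩ := h (ε / 2) (half_pos hε)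
  refine ⟨δ, hδ, fun {t} ht htδ => ?_⟩
  have ht0 : (0 : ℝ) < t := by exact_mod_cast ht
  have ht' : ((t : ℝ) : 𝕜) ≠ 0 := by exact_mod_cast ht0.ne'
  have htδ' : (t : ℝ) < δ := by
    rw [NNReal.dist_eq] at htδ
    simpa using htδ
  rw [dist_eq_norm]
  have : ((t : ℝ) : 𝕜)⁻¹ • (T t x - x) - y =
      ((t : ℝ) : 𝕜)⁻¹ • (T t x - x - ((t : ℝ) : 𝕜) • y) := by
    rw [smul_sub _ (T t x - x), inv_smul_smul₀ ht']
  rw [this, norm_smul, norm_inv, RCLike.norm_ofReal, abs_of_pos ht0, inv_mul_lt_iff₀ ht0]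
  have := H t htδ'
  nlinarith

/-- The orbit of `z ∈ D(A)` has right derivative `T(t) A z` at every time `t`. -/
theorem hasDerivWithinAt_orbit [NormedSpace ℝ X] [IsScalarTower ℝ 𝕜 X] (z : T.DomSpace) {t : ℝ}
    (ht : 0 ≤ t) : HasDerivWithinAt (fun s : ℝ => T s.toNNReal (DomSpace.val T z))
      (T t.toNNReal (DomSpace.gen T z)) (Ici t) t := by
  rw [← hasDerivWithinAt_Ioi_iff_Ici, hasDerivWithinAt_iff_tendsto_slope' (by simp)]
  have h1 : Tendsto (fun s : ℝ => (s - t).toNNReal) (𝓝[>] t) (𝓝[>] 0) := by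
    refine tendsto_nhdsWithin_iff.2 ⟨?_, ?_⟩
    · have : Continuous fun s : ℝ => (s - t).toNNReal := by fun_prop
      simpa using (this.tendsto t).mono_left nhdsWithin_le_nhds
    · filter_upwards [self_mem_nhdsWithin] with s hs
      exact Real.toNNReal_pos.2 (sub_pos.2 hs)
  have h2 := ((T t.toNNReal).continuous.tendsto _).comp
    ((T.hasOrbitDeriv_generator z : T.HasOrbitDeriv _ _).comp h1)
  refine h2.congr' ?_
  filter_upwards [self_mem_nhdsWithin] with s hs
  have hs : t < s := hs
  have h3 : s.toNNReal = t.toNNReal + (s - t).toNNReal := by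
    rw [← Real.toNNReal_add ht (sub_pos.2 hs).le, add_sub_cancel]
  simp only [Function.comp_apply, slope, vsub_eq_sub]
  rw [h3, apply_add, ← map_sub, Real.coe_toNNReal _ (sub_pos.2 hs).le, ← RCLike.ofReal_inv,
    map_smul, ← RCLike.real_smul_eq_coe_smul (K := 𝕜)]
  rfl

/-- The mean value inequality for the orbit of `z ∈ D(A)`, seen through a bounded operator `f`. -/
theorem norm_orbit_sub_le {G : Type*} [NormedAddCommGroup G] [NormedSpace 𝕜 G]
    (f : X →L[𝕜] G) (z : T.DomSpace) (y : G) {t : ℝ≥0} {C : ℝ}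
    (h : ∀ s ≤ t, ‖f (T s (DomSpace.gen T z)) - y‖ ≤ C) :
    ‖f (T t (DomSpace.val T z)) - f (DomSpace.val T z) - ((t : ℝ) : 𝕜) • y‖ ≤ C * t := by
  let : NormedSpace ℝ X := NormedSpace.restrictScalars ℝ 𝕜 X
  have : IsScalarTower ℝ 𝕜 X := RestrictScalars.isScalarTower ℝ 𝕜 X
  let : NormedSpace ℝ G := NormedSpace.restrictScalars ℝ 𝕜 G
  have : IsScalarTower ℝ 𝕜 G := RestrictScalars.isScalarTower ℝ 𝕜 G
  have hd : ∀ s ∈ Ico (0 : ℝ) t, HasDerivWithinAt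
      (fun s : ℝ => f (T s.toNNReal (DomSpace.val T z)) - s • y)
      (f (T s.toNNReal (DomSpace.gen T z)) - y) (Ici s) s := fun s hs => by
    have h1 := ((f.restrictScalars ℝ).hasFDerivAt.comp_hasDerivWithinAt s
      (hasDerivWithinAt_orbit z hs.1))
    have h2 := ((hasDerivAt_id s).smul_const y).hasDerivWithinAt (s := Ici s)
    rw [one_smul] at h2
    exact h1.sub h2
  have hc : Continuous fun s : ℝ => f (T s.toNNReal (DomSpace.val T z)) - s • y := by
    have := (T.continuous_orbit (DomSpace.val T z)).comp continuous_real_toNNReal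
    exact (f.continuous.comp this).sub (by fun_prop)
  have := norm_image_sub_le_of_norm_deriv_right_le_segment hc.continuousOn hd
    (fun s hs => h _ (Real.toNNReal_le_iff_le_coe.2 hs.2.le)) t ⟨t.2, le_rfl⟩
  simp only [Real.toNNReal_coe, Real.toNNReal_zero, zero_smul, sub_zero, apply_zero] at this
  rw [← RCLike.real_smul_eq_coe_smul (K := 𝕜)]
  convert this using 2
  abel

theorem exists_forall_norm_sub_le (x : X) {ε : ℝ} (hε : 0 < ε) :
    ∃ δ : ℝ, 0 < δ ∧ ∀ s : ℝ≥0, (s : ℝ) < δ → ‖T s x - x‖ ≤ ε := by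
  obtain ⟨δ, hδ, h⟩ := Metric.continuous_iff.1 (T.continuous_orbit x) 0 ε hε
  refine ⟨δ, hδ, fun s hs => ?_⟩
  have := h s (by rw [NNReal.dist_eq]; simpa using hs)
  rw [apply_zero, dist_eq_norm] at this
  exact this.le

/-- The generator is closed. -/
theorem hasOrbitDeriv_of_tendsto [CompleteSpace X] {z : ℕ → T.DomSpace} {x y : X}
    (hx : Tendsto (fun n => DomSpace.val T (z n)) atTop (𝓝 x))
    (hy : Tendsto (fun n => DomSpace.gen T (z n)) atTop (𝓝 y)) : T.HasOrbitDeriv x y := by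
  refine hasOrbitDeriv_of_forall fun ε hε => ?_
  obtain ⟨δ, hδ, hδ'⟩ := exists_forall_norm_sub_le (T := T) y hε
  refine ⟨δ, hδ, fun t ht => ?_⟩
  obtain ⟨M, hM0, hM⟩ := T.exists_norm_le t
  have h1 : ∀ n, ‖T t (DomSpace.val T (z n)) - DomSpace.val T (z n) - ((t : ℝ) : 𝕜) • y‖ ≤
      (M * ‖DomSpace.gen T (z n) - y‖ + ε) * t := fun n => by
    refine norm_orbit_sub_le (.id 𝕜 X) (z n) y fun s hs => ?_
    have h2 : T s (DomSpace.gen T (z n)) - y =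
        T s (DomSpace.gen T (z n) - y) + (T s y - y) := by
      rw [map_sub]; abel
    simp only [ContinuousLinearMap.id_apply]
    rw [h2]
    refine (norm_add_le _ _).trans (add_le_add ?_ (hδ' s ((NNReal.coe_le_coe.2 hs).trans_lt ht)))
    exact ((T s).le_opNorm _).trans (mul_le_mul_of_nonneg_right (hM s hs) (norm_nonneg _))
  have h3 : Tendsto (fun n => (M * ‖DomSpace.gen T (z n) - y‖ + ε) * (t : ℝ)) atTop
      (𝓝 ((M * ‖y - y‖ + ε) * t)) :=
    ((((hy.sub_const y).norm.const_mul M).add_const ε).mul_const _)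
  have h4 : Tendsto (fun n => ‖T t (DomSpace.val T (z n)) - DomSpace.val T (z n) -
      ((t : ℝ) : 𝕜) • y‖) atTop (𝓝 ‖T t x - x - ((t : ℝ) : 𝕜) • y‖) :=
    ((((T t).continuous.tendsto x).comp hx).sub hx |>.sub_const _).norm
  simpa using le_of_tendsto_of_tendsto' h4 h3 h1

theorem HasOrbitDeriv.exists_domSpace {x y : X} (h : T.HasOrbitDeriv x y) :
    ∃ z : T.DomSpace, DomSpace.val T z = x ∧ DomSpace.gen T z = y :=
  ⟨(⟨x, y, h⟩ : T.domain), rfl, (T.hasOrbitDeriv_generator ⟨x, y, h⟩).unique h⟩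

variable (T)

/-- `∫₀ᵗ T(s) x ds` belongs to `D(A)`. -/
theorem hasOrbitDeriv_integral [CompleteSpace X] [NormedSpace ℝ X] [IsScalarTower ℝ 𝕜 X] (x : X)
    {t : ℝ} (ht : 0 ≤ t) :
    T.HasOrbitDeriv (∫ s in (0)..t, T s.toNNReal x) (T t.toNNReal x - x) := by
  have hc : Continuous fun s : ℝ => T s.toNNReal x :=
    (T.continuous_orbit x).comp continuous_real_toNNReal
  have hi : ∀ a b, IntervalIntegrable (fun s : ℝ => T s.toNNReal x) volume a b :=
    hc.intervalIntegrable
  set G : ℝ → X := fun r => ∫ s in (0)..r, T s.toNNReal x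
  have hG : ∀ r, HasDerivAt G (T r.toNNReal x) r := fun r =>
    (hc.integral_hasStrictDerivAt 0 r).hasDerivAt
  have hcoe : Tendsto (fun h : ℝ≥0 => (h : ℝ)) (𝓝[>] 0) (𝓝[>] 0) := by
    refine tendsto_nhdsWithin_iff.2 ⟨?_, ?_⟩
    · exact (NNReal.continuous_coe.tendsto' 0 0 rfl).mono_left nhdsWithin_le_nhds
    · filter_upwards [self_mem_nhdsWithin] with s hs
      exact_mod_cast hs
  have h1 := ((hG t).tendsto_slope_zero_right.comp hcoe).sub
    ((hG 0).tendsto_slope_zero_right.comp hcoe)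
  rw [Real.toNNReal_zero, apply_zero] at h1
  refine h1.congr fun h => ?_
  have hsplit : T h (G t) = G (t + h) - G h := by
    have h2 : T h (G t) = ∫ s in (0)..t, T h (T s.toNNReal x) :=
      ((T h).intervalIntegral_comp_comm (hi 0 t)).symm
    have h3 : ∫ s in (0)..t, T h (T s.toNNReal x) =
        ∫ s in (0)..t, T ((h : ℝ) + s).toNNReal x := by
      refine intervalIntegral.integral_congr fun s hs => ?_
      rw [uIcc_of_le ht] at hs
      rw [Real.toNNReal_add (NNReal.coe_nonneg h) hs.1, apply_add, Real.toNNReal_coe]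
    rw [h2, h3, intervalIntegral.integral_comp_add_left (fun s => T s.toNNReal x), add_zero,
      add_comm (h : ℝ) t, ← intervalIntegral.integral_interval_sub_left (hi 0 _) (hi 0 _)]
  have hG0 : G 0 = 0 := intervalIntegral.integral_same
  simp only [Function.comp_apply, zero_add, hG0, sub_zero]
  rw [← smul_sub, ← RCLike.ofReal_inv, ← RCLike.real_smul_eq_coe_smul (K := 𝕜), hsplit]
  congr 1
  abel

/-- The domain of the generator is dense. -/
theorem denseRange_val [CompleteSpace X] : DenseRange (DomSpace.val T) := by
  let : NormedSpace ℝ X := NormedSpace.restrictScalars ℝ 𝕜 X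
  have : IsScalarTower ℝ 𝕜 X := RestrictScalars.isScalarTower ℝ 𝕜 X
  intro x
  have hc : Continuous fun s : ℝ => T s.toNNReal x :=
    (T.continuous_orbit x).comp continuous_real_toNNReal
  have h1 := (hc.integral_hasStrictDerivAt 0 0).hasDerivAt.tendsto_slope_zero_right
  simp only [zero_add, intervalIntegral.integral_same, sub_zero, Real.toNNReal_zero,
    apply_zero] at h1
  refine mem_closure_of_tendsto h1 ?_
  filter_upwards [self_mem_nhdsWithin] with t ht
  obtain ⟨z, hz, -⟩ := (T.hasOrbitDeriv_integral x (le_of_lt ht)).exists_domSpace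
  exact ⟨((t⁻¹ : ℝ) : 𝕜) • z, by rw [map_smul, hz, ← RCLike.real_smul_eq_coe_smul (K := 𝕜)]⟩

/-- The semigroup is strongly continuous on `X₁`. -/
theorem continuous_evolve (z : T.DomSpace) : Continuous fun t => DomSpace.evolve t z := by
  refine continuous_iff_continuousAt.2 fun t => tendsto_iff_norm_sub_tendsto_zero.2 ?_
  have h1 := tendsto_iff_norm_sub_tendsto_zero.1
    ((T.continuous_orbit (DomSpace.val T z)).tendsto t)
  have h2 := tendsto_iff_norm_sub_tendsto_zero.1
    ((T.continuous_orbit (DomSpace.gen T z)).tendsto t)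
  have h3 := h1.add h2
  rw [add_zero] at h3
  refine h3.congr fun s => ?_
  rw [DomSpace.norm_def]
  have h4 : DomSpace.genₗ T (DomSpace.evolve s z - DomSpace.evolve t z) =
      T s (DomSpace.gen T z) - T t (DomSpace.gen T z) := by
    rw [map_sub]
    exact congrArg₂ _ (DomSpace.gen_evolve s z) (DomSpace.gen_evolve t z)
  rw [h4]
  rfl

theorem continuous_output {Y : Type*} [NormedAddCommGroup Y] [NormedSpace 𝕜 Y]
    (C : T.DomSpace →L[𝕜] Y) (z : T.DomSpace) : Continuous (T.output C z) :=
  C.continuous.comp ((T.continuous_evolve z).comp continuous_real_toNNReal)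

end Basic

/-! ### The dual semigroup and its resolvents -/

section Dual

variable (T : C0Semigroup 𝕜 X) (hT : ∀ f : StrongDual 𝕜 X, Continuous fun t : ℝ≥0 => f.comp (T t))

/-- If `⟨h, A z⟩ = ⟨k, z⟩` on `D(A)`, then `h` belongs to the domain of the generator of the dual
semigroup, which maps `h` to `k`. -/
theorem dual_hasOrbitDeriv [CompleteSpace X] {h k : StrongDual 𝕜 X}
    (hk : ∀ z : T.DomSpace, h (DomSpace.gen T z) = k (DomSpace.val T z)) :
    (T.dual hT).HasOrbitDeriv h k := by
  refine hasOrbitDeriv_of_forall fun ε hε => ?_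
  obtain ⟨δ, hδ, hδ'⟩ := exists_forall_norm_sub_le (T := T.dual hT) k hε
  refine ⟨δ, hδ, fun t ht => ContinuousLinearMap.opNorm_le_bound _ (by positivity) fun x => ?_⟩
  refine (T.denseRange_val).induction_on x ?_ fun z => ?_
  · exact isClosed_le (by fun_prop) (by fun_prop)
  · have h1 := norm_orbit_sub_le (T := T) h z (k (DomSpace.val T z)) (t := t)
      (C := ε * ‖DomSpace.val T z‖) fun s hs => by
        rw [← DomSpace.gen_evolve, hk]
        exact (((T.dual hT) s k - k).le_opNorm (DomSpace.val T z)).trans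
          (mul_le_mul_of_nonneg_right (hδ' s ((NNReal.coe_le_coe.2 hs).trans_lt ht))
            (norm_nonneg _))
    rw [mul_right_comm] at h1
    exact h1

theorem dual_shift_apply (β : 𝕜) (w : (T.dual hT).DomSpace) (z : T.DomSpace) :
    DomSpace.shift (T.dual hT) β w (DomSpace.val T z) =
      DomSpace.val (T.dual hT) w (DomSpace.shift T β z) := by
  simp [DomSpace.shift, T.dual_gen_apply hT w z]

theorem shift_surjective {T : C0Semigroup 𝕜 X} {β : 𝕜} (hβ : β ∈ T.resolventSet) :
    Function.Surjective (DomSpace.shift T β) := fun x => by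
  obtain ⟨z, -, hz⟩ := (T.isResolvent_resolventOp hβ).1 x
  exact ⟨z, hz⟩

/-- `β - A : X₁ → X` has a bounded inverse for the graph norm. -/
theorem exists_shift_inverse {T : C0Semigroup 𝕜 X} {β : 𝕜} (hβ : β ∈ T.resolventSet) :
    ∃ S : X →L[𝕜] T.DomSpace, ∀ z, S (DomSpace.shift T β z) = z := by
  obtain ⟨R, hR1, hR2⟩ := hβ
  have hinj : Function.Injective (DomSpace.shift T β).toLinearMap := fun z w h =>
    Subtype.ext (((hR2 z).symm.trans (congrArg R h)).trans (hR2 w))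
  have hsurj : Function.Surjective (DomSpace.shift T β).toLinearMap := fun x => by
    obtain ⟨z, -, hz⟩ := hR1 x
    exact ⟨z, hz⟩
  let e := LinearEquiv.ofBijective (DomSpace.shift T β).toLinearMap ⟨hinj, hsurj⟩
  refine ⟨e.symm.toLinearMap.mkContinuous (‖R‖ + (‖β‖ * ‖R‖ + 1)) fun x => ?_,
    e.symm_apply_apply⟩
  obtain ⟨z, rfl⟩ := hsurj x
  change ‖e.symm (e z)‖ ≤ _ * ‖DomSpace.shift T β z‖
  rw [e.symm_apply_apply, DomSpace.norm_def]
  have h1 : ‖DomSpace.val T z‖ ≤ ‖R‖ * ‖DomSpace.shift T β z‖ := by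
    rw [← hR2 z]
    exact R.le_opNorm _
  have h2 : DomSpace.gen T z = β • DomSpace.val T z - DomSpace.shift T β z :=
    (sub_sub_cancel _ _).symm
  have h3 : ‖DomSpace.gen T z‖ ≤ ‖β‖ * ‖DomSpace.val T z‖ + ‖DomSpace.shift T β z‖ := by
    rw [h2, ← norm_smul]
    exact norm_sub_le _ _
  have h4 := mul_le_mul_of_nonneg_left h1 (norm_nonneg β)
  calc ‖DomSpace.valₗ T z‖ + ‖DomSpace.genₗ T z‖ ≤ _ := add_le_add h1 h3
    _ ≤ _ := by linarith

/-- The resolvent of the dual semigroup is the adjoint of the resolvent. -/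
theorem mem_resolventSet_dual [CompleteSpace X] {β : 𝕜} (hβ : β ∈ T.resolventSet) :
    β ∈ (T.dual hT).resolventSet := by
  obtain ⟨R, hR1, hR2⟩ := hβ
  refine ⟨ContinuousLinearMap.precomp 𝕜 R, fun f => ?_, fun w => ?_⟩
  · obtain ⟨w, hw, hw'⟩ := (T.dual_hasOrbitDeriv hT (h := f.comp R) (k := β • f.comp R - f)
      fun z => by
        have h1 := congrArg f (hR2 z)
        simp only [DomSpace.shift, sub_apply, smul_apply, map_sub, map_smul] at h1
        simp only [sub_apply, smul_apply, ContinuousLinearMap.comp_apply]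
        rw [← h1]
        abel).exists_domSpace
    refine ⟨w, hw, ?_⟩
    change β • DomSpace.val (T.dual hT) w - DomSpace.gen (T.dual hT) w = f
    rw [hw, hw', sub_sub_cancel]
  · ext x
    obtain ⟨z, hz, rfl⟩ := hR1 x
    change DomSpace.shift (T.dual hT) β w (R (DomSpace.shift T β z)) = _
    rw [← hz, dual_shift_apply]

/-- A closed subspace with zero annihilator is the whole space, by Hahn-Banach in the quotient. -/
theorem _root_.Submodule.eq_top_of_forall_dual {S : Submodule 𝕜 X} (hS : IsClosed (S : Set X))
    (h : ∀ f : StrongDual 𝕜 X, (∀ x ∈ S, f x = 0) → f = 0) : S = ⊤ := by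
  refine Submodule.eq_top_iff'.2 fun x => ?_
  by_contra hx
  have := hS
  have hne : ‖S.mkQL x‖ ≠ 0 := by
    rw [norm_ne_zero_iff]
    exact fun h0 => hx ((Submodule.Quotient.mk_eq_zero S).1 h0)
  obtain ⟨g, -, hg⟩ := exists_dual_vector 𝕜 (S.mkQL x) hne
  have h1 := h (g.comp S.mkQL) fun y hy => by
    have : S.mkQL y = 0 := (Submodule.Quotient.mk_eq_zero S).2 hy
    simp [this]
  have h2 : g (S.mkQL x) = 0 := DFunLike.congr_fun h1 x
  rw [hg] at h2
  exact hne (by exact_mod_cast h2)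

/-- The resolvent set of the dual semigroup is contained in that of the semigroup: `β - A` is
bounded below and has dense range because `β - A'` is onto and injective. -/
theorem mem_resolventSet_of_dual [CompleteSpace X] {β : 𝕜} (hβ : β ∈ (T.dual hT).resolventSet) :
    β ∈ T.resolventSet := by
  obtain ⟨R, hR1, hR2⟩ := hβ
  have hbound : ∀ z : T.DomSpace, ‖DomSpace.val T z‖ ≤ ‖R‖ * ‖DomSpace.shift T β z‖ := by
    intro z
    refine NormedSpace.norm_le_dual_bound 𝕜 _ (by positivity) fun f => ?_
    obtain ⟨w, hw, rfl⟩ := hR1 f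
    rw [dual_shift_apply, hw]
    refine ((R _).le_opNorm _).trans ?_
    rw [mul_right_comm]
    exact mul_le_mul_of_nonneg_right (R.le_opNorm _) (norm_nonneg _)
  have hclosed : IsClosed ((DomSpace.shift T β).toLinearMap.range : Set X) := by
    refine isClosed_of_closure_subset fun y hy => ?_
    obtain ⟨v, hv, hvy⟩ := mem_closure_iff_seq_limit.1 hy
    choose z hz using hv
    have hz : ∀ n, DomSpace.shift T β (z n) = v n := hz
    have hcauchy : CauchySeq fun n => DomSpace.val T (z n) := by
      refine Metric.cauchySeq_iff.2 fun ε hε => ?_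
      obtain ⟨N, hN⟩ := Metric.cauchySeq_iff.1 hvy.cauchySeq (ε / (‖R‖ + 1)) (by positivity)
      refine ⟨N, fun m hm n hn => ?_⟩
      have h1 := hN m hm n hn
      have h2 := hbound (z m - z n)
      rw [dist_eq_norm, lt_div_iff₀ (by positivity)] at h1
      rw [map_sub, map_sub, hz, hz] at h2
      rw [dist_eq_norm]
      nlinarith [norm_nonneg (v m - v n)]
    obtain ⟨x, hx⟩ := cauchySeq_tendsto_of_complete hcauchy
    have hgen : Tendsto (fun n => DomSpace.gen T (z n)) atTop (𝓝 (β • x - y)) := by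
      refine ((hx.const_smul β).sub hvy).congr fun n => ?_
      rw [← hz n]
      simp [DomSpace.shift]
    obtain ⟨w, hw, hw'⟩ := (hasOrbitDeriv_of_tendsto hx hgen).exists_domSpace
    refine ⟨w, ?_⟩
    change β • DomSpace.val T w - DomSpace.gen T w = y
    rw [hw, hw', sub_sub_cancel]
  have htop : (DomSpace.shift T β).toLinearMap.range = ⊤ := by
    refine Submodule.eq_top_of_forall_dual hclosed fun f hf => ?_
    obtain ⟨w, hw, hw'⟩ := (T.dual_hasOrbitDeriv hT (h := f) (k := β • f) fun z => by
      have h1 : f (DomSpace.shift T β z) = 0 := hf _ ⟨z, rfl⟩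
      simp only [DomSpace.shift, sub_apply, smul_apply, map_sub, map_smul, sub_eq_zero] at h1
      simpa using h1.symm).exists_domSpace
    have h2 : DomSpace.shift (T.dual hT) β w = 0 := by
      change β • DomSpace.val (T.dual hT) w - DomSpace.gen (T.dual hT) w = 0
      rw [hw, hw', sub_self]
    rw [← hw, ← hR2, h2, _root_.map_zero]
  have hinj : Function.Injective (DomSpace.shift T β).toLinearMap := by
    refine (injective_iff_map_eq_zero _).2 fun z hz => Subtype.ext ?_
    have h1 := hbound z
    have hz : DomSpace.shift T β z = 0 := hz
    rw [hz, norm_zero, mul_zero] at h1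
    exact norm_le_zero_iff.1 h1
  let e := LinearEquiv.ofBijective (DomSpace.shift T β).toLinearMap
    ⟨hinj, LinearMap.range_eq_top.1 htop⟩
  have he : ∀ x, DomSpace.shift T β (e.symm x) = x := e.apply_symm_apply
  refine ⟨((DomSpace.val T).toLinearMap ∘ₗ e.symm.toLinearMap).mkContinuous ‖R‖ fun x => ?_,
    fun x => ⟨e.symm x, rfl, he x⟩, fun z => congrArg (DomSpace.val T) (e.symm_apply_apply z)⟩
  have := hbound (e.symm x)
  rwa [he] at this

end Dual

end C0Semigroup

/-! ### The extrapolation space -/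

namespace C0Semigroup

variable {𝕜 : Type*} [RCLike 𝕜] {X : Type*} [NormedAddCommGroup X] [NormedSpace 𝕜 X]

/-- A functional on `D(A)` that is bounded for the norm of `X` extends to `X`. -/
theorem exists_strongDual_extension [CompleteSpace X] (T : C0Semigroup 𝕜 X)
    (l : T.DomSpace →ₗ[𝕜] 𝕜) {K : ℝ} (hK : 0 ≤ K) (hl : ∀ z, ‖l z‖ ≤ K * ‖DomSpace.val T z‖) :
    ∃ f : StrongDual 𝕜 X, ‖f‖ ≤ K ∧ ∀ z, f (DomSpace.val T z) = l z :=
  ⟨l.extendOfNorm (DomSpace.val T).toLinearMap,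
    LinearMap.opNorm_extendOfNorm_le T.denseRange_val hK hl,
    LinearMap.extendOfNorm_eq T.denseRange_val ⟨K, hl⟩⟩

theorem strongDual_ext [CompleteSpace X] (T : C0Semigroup 𝕜 X) {f g : StrongDual 𝕜 X}
    (h : ∀ z, f (DomSpace.val T z) = g (DomSpace.val T z)) : f = g :=
  DFunLike.coe_injective (T.denseRange_val.equalizer f.continuous g.continuous (funext h))

/-- The norm of a functional on `X` can be computed on `D(A)`. -/
theorem opNorm_le_of_forall [CompleteSpace X] (T : C0Semigroup 𝕜 X) {f : StrongDual 𝕜 X} {K : ℝ}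
    (hK : 0 ≤ K) (h : ∀ z, ‖f (DomSpace.val T z)‖ ≤ K * ‖DomSpace.val T z‖) : ‖f‖ ≤ K := by
  obtain ⟨g, hg, hgf⟩ := T.exists_strongDual_extension
    (f.toLinearMap ∘ₗ (DomSpace.val T).toLinearMap) hK h
  rwa [T.strongDual_ext (f := f) fun z => (hgf z).symm]

section Extrap

variable (T : C0Semigroup 𝕜 X) {β : 𝕜} (hβ : β ∈ T.resolventSet)

theorem norm_incl (x : X) : ‖T.incl hβ x‖ = ‖T.resolventOp hβ x‖ := T.norm_inclₗ hβ x

theorem denseRange_incl : DenseRange (T.incl hβ) := T.denseRange_inclₗ hβ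

variable [CompleteSpace X]

theorem norm_resolventExt (w : ExtrapSpace hβ) : ‖T.resolventExt hβ w‖ = ‖w‖ := by
  refine (T.denseRange_incl hβ).induction_on w ?_ fun x => ?_
  · exact isClosed_eq (by fun_prop) (by fun_prop)
  · rw [resolventExt_incl, norm_incl]

/-- The resolvent as an isometry from `X₋₁` into `X`. -/
noncomputable def resolventExtₗᵢ : ExtrapSpace hβ →ₗᵢ[𝕜] X :=
  ⟨(T.resolventExt hβ).toLinearMap, T.norm_resolventExt hβ⟩

theorem resolventExt_injective : Function.Injective (T.resolventExt hβ) :=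
  (T.resolventExtₗᵢ hβ).injective

theorem resolventExt_extrap (t : ℝ≥0) (w : ExtrapSpace hβ) :
    T.resolventExt hβ (T.extrap hβ t w) = T t (T.resolventExt hβ w) := by
  refine (T.denseRange_incl hβ).induction_on w ?_ fun x => ?_
  · exact isClosed_eq (by fun_prop) (by fun_prop)
  · rw [extrap_incl, resolventExt_incl, resolventExt_incl, resolventOp_comm]

/-- The range of the extended resolvent is closed and contains `D(A)`. -/
theorem resolventExt_surjective : Function.Surjective (T.resolventExt hβ) := by
  have hclosed : IsClosed (range (T.resolventExt hβ)) :=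
    (T.resolventExtₗᵢ hβ).isometry.isClosedEmbedding.isClosed_range
  rw [← range_eq_univ, ← hclosed.closure_eq]
  refine eq_univ_of_univ_subset ?_
  rw [← T.denseRange_val.closure_range]
  refine closure_mono ?_
  rintro _ ⟨z, rfl⟩
  refine ⟨T.incl hβ (DomSpace.shift T β z), ?_⟩
  rw [resolventExt_incl, (T.isResolvent_resolventOp hβ).2]

/-- An element of `X₋₁` lies in `X` as soon as the resolvent maps it into `D(A)`. -/
theorem exists_incl_eq_of_resolventExt {w : ExtrapSpace hβ} {z : T.DomSpace}
    (h : T.resolventExt hβ w = DomSpace.val T z) : ∃ x, T.incl hβ x = w := by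
  refine ⟨DomSpace.shift T β z, T.resolventExt_injective hβ ?_⟩
  rw [resolventExt_incl, (T.isResolvent_resolventOp hβ).2, h]

end Extrap

/-! ### The input map -/

section Input

variable (T : C0Semigroup 𝕜 X) {β : 𝕜} {hβ : β ∈ T.resolventSet}
  {U : Type*} [NormedAddCommGroup U] [NormedSpace 𝕜 U] (B : U →L[𝕜] ExtrapSpace hβ)

theorem inputMap_congr {τ : ℝ} {u v : ℝ → U} (h : u =ᵐ[lebesgueUpTo τ] v) :
    T.inputMap B τ u = T.inputMap B τ v := by
  refine integral_congr_ae ?_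
  filter_upwards [h] with s hs
  rw [hs]

theorem inputMap_neg {τ : ℝ} (u : ℝ → U) :
    T.inputMap B τ (fun s => -u s) = -T.inputMap B τ u := by
  rw [inputMap, inputMap, ← integral_neg]
  simp only [map_neg]

variable [CompleteSpace X]

instance isFiniteMeasure_lebesgueUpTo (τ : ℝ) : IsFiniteMeasure (lebesgueUpTo τ) :=
  ⟨by simp [lebesgueUpTo]⟩

theorem integrable_convolution {τ : ℝ} {v : ℝ → X} (hv : Integrable v (lebesgueUpTo τ)) :
    Integrable (fun s => T (τ - s).toNNReal (v s)) (lebesgueUpTo τ) := by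
  obtain ⟨M, hM0, hM⟩ := T.exists_norm_le τ.toNNReal
  refine (hv.norm.const_mul M).mono' ?_ ?_
  · have h : Continuous fun s : ℝ => (τ - s).toNNReal := by fun_prop
    exact T.continuous_uncurry.comp_aestronglyMeasurable (h.aestronglyMeasurable.prodMk hv.1)
  · filter_upwards [ae_restrict_mem measurableSet_Ioo] with s hs
    refine ((T _).le_opNorm _).trans (mul_le_mul_of_nonneg_right (hM _ ?_) (norm_nonneg _))
    exact Real.toNNReal_le_toNNReal (by linarith [hs.1])

/-- No integrability is needed: the resolvent is isometric, so both integrals take the junk value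
`0` together. -/
theorem resolventExt_inputMap [NormedSpace ℝ X] [IsScalarTower ℝ 𝕜 X] (τ : ℝ) (u : ℝ → U) :
    T.resolventExt hβ (T.inputMap B τ u) =
      ∫ s, T (τ - s).toNNReal (T.resolventExt hβ (B (u s))) ∂(lebesgueUpTo τ) := by
  have h := (T.resolventExtₗᵢ hβ).integral_comp_comm (μ := lebesgueUpTo τ)
    fun s => T.extrap hβ (τ - s).toNNReal (B (u s))
  refine h.symm.trans (integral_congr_ae (Eventually.of_forall fun s => ?_))
  exact T.resolventExt_extrap hβ _ _

theorem inputMap_add {τ : ℝ} {u v : ℝ → U} (hu : Integrable u (lebesgueUpTo τ))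
    (hv : Integrable v (lebesgueUpTo τ)) :
    T.inputMap B τ (fun s => u s + v s) = T.inputMap B τ u + T.inputMap B τ v := by
  let : NormedSpace ℝ X := NormedSpace.restrictScalars ℝ 𝕜 X
  have : IsScalarTower ℝ 𝕜 X := RestrictScalars.isScalarTower ℝ 𝕜 X
  have hi : ∀ {w : ℝ → U}, Integrable w (lebesgueUpTo τ) →
      Integrable (fun s => T (τ - s).toNNReal (T.resolventExt hβ (B (w s)))) (lebesgueUpTo τ) :=
    fun hw => T.integrable_convolution (((T.resolventExt hβ).comp B).integrable_comp hw)
  apply T.resolventExt_injective hβ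
  rw [_root_.map_add]
  simp only [resolventExt_inputMap]
  rw [← integral_add (hi hu) (hi hv)]
  simp only [_root_.map_add]

theorem inputMap_sub {τ : ℝ} {u v : ℝ → U} (hu : Integrable u (lebesgueUpTo τ))
    (hv : Integrable v (lebesgueUpTo τ)) :
    T.inputMap B τ (fun s => u s - v s) = T.inputMap B τ u - T.inputMap B τ v := by
  simp only [sub_eq_add_neg]
  rw [← inputMap_neg]
  exact T.inputMap_add B hu hv.neg

/-- Pairing the input map with a functional applied after the resolvent. -/
theorem apply_resolventExt_inputMap {τ : ℝ} {u : ℝ → U} (hu : Integrable u (lebesgueUpTo τ))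
    (f : StrongDual 𝕜 X) : f (T.resolventExt hβ (T.inputMap B τ u)) =
      ∫ s, f (T (τ - s).toNNReal (T.resolventExt hβ (B (u s)))) ∂(lebesgueUpTo τ) := by
  let : NormedSpace ℝ X := NormedSpace.restrictScalars ℝ 𝕜 X
  have : IsScalarTower ℝ 𝕜 X := RestrictScalars.isScalarTower ℝ 𝕜 X
  rw [resolventExt_inputMap]
  exact (f.integral_comp_comm (T.integrable_convolution
    (((T.resolventExt hβ).comp B).integrable_comp hu))).symm

end Input

section Pairing

variable (T : C0Semigroup 𝕜 X) (hT : ∀ f : StrongDual 𝕜 X, Continuous fun t : ℝ≥0 => f.comp (T t))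
  {β : 𝕜}

/-- The control problem for `C'` is dual to the observation by `C`, with time reversed. -/
theorem pairExtrapDom_inputMap {Y : Type*} [NormedAddCommGroup Y] [NormedSpace 𝕜 Y]
    {hβ : β ∈ (T.dual hT).resolventSet} {C : T.DomSpace →L[𝕜] Y}
    {C' : StrongDual 𝕜 Y →L[𝕜] ExtrapSpace hβ} (hC : T.IsDualObservation hT hβ C C') {τ : ℝ}
    {g : ℝ → StrongDual 𝕜 Y} (hg : Integrable g (lebesgueUpTo τ)) (x : T.DomSpace) :
    T.pairExtrapDom hT hβ ((T.dual hT).inputMap C' τ g) x =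
      ∫ s, g s (T.output C x (τ - s)) ∂(lebesgueUpTo τ) := by
  have h := (T.dual hT).apply_resolventExt_inputMap C' hg
    (NormedSpace.inclusionInDoubleDual 𝕜 X (DomSpace.shift T β x))
  refine h.trans (integral_congr_ae (Eventually.of_forall fun s => ?_))
  refine Eq.trans ?_ (hC (g s) (DomSpace.evolve (τ - s).toNNReal x))
  exact congrArg ((T.dual hT).resolventExt hβ (C' (g s))) (DomSpace.shift_evolve β _ x).symm

variable [CompleteSpace X]

/-- The control problem for `B` is dual to the observation by `B'`, with time reversed. -/
theorem pairDomExtrap_inputMap {U : Type*} [NormedAddCommGroup U] [NormedSpace 𝕜 U]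
    {hβ : β ∈ T.resolventSet} (B : U →L[𝕜] ExtrapSpace hβ) {τ : ℝ} {u : ℝ → U}
    (hu : Integrable u (lebesgueUpTo τ)) (f : (T.dual hT).DomSpace) :
    T.pairDomExtrap hT hβ f (T.inputMap B τ u) =
      ∫ s, (T.dual hT).output (T.dualControl hT hβ B) f (τ - s) (u s) ∂(lebesgueUpTo τ) := by
  have h := T.apply_resolventExt_inputMap B hu (DomSpace.shift (T.dual hT) β f)
  refine h.trans (integral_congr_ae (Eventually.of_forall fun s => ?_))
  exact (DFunLike.congr_fun (DomSpace.shift_evolve β (τ - s).toNNReal f)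
    (T.resolventExt hβ (B (u s)))).symm

/-- `X₁` separates the points of `X₋₁ᵈ`. -/
theorem pairExtrapDom_injective (hβ : β ∈ (T.dual hT).resolventSet) :
    Function.Injective (T.pairExtrapDom hT hβ) := by
  intro v w h
  apply (T.dual hT).resolventExt_injective hβ
  ext x
  obtain ⟨z, rfl⟩ := shift_surjective (T.mem_resolventSet_of_dual hT hβ) x
  exact DFunLike.congr_fun h z

/-- `X₁ᵈ` separates the points of `X₋₁`. -/
theorem extrap_ext_of_pairDomExtrap {hβ : β ∈ T.resolventSet} {v w : ExtrapSpace hβ}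
    (h : ∀ f, T.pairDomExtrap hT hβ f v = T.pairDomExtrap hT hβ f w) : v = w := by
  apply T.resolventExt_injective hβ
  refine (SeparatingDual.eq_iff_forall_dual_eq (R := 𝕜)).2 fun g => ?_
  obtain ⟨f, rfl⟩ := shift_surjective (T.mem_resolventSet_dual hT hβ) g
  exact h f

/-- Every observation operator has a unique dual control operator, since `X₋₁ᵈ` is the dual space
of `X₁`. -/
theorem existsUnique_isDualObservation {Y : Type*} [NormedAddCommGroup Y] [NormedSpace 𝕜 Y]
    (hβ : β ∈ (T.dual hT).resolventSet) (C : T.DomSpace →L[𝕜] Y) :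
    ∃! C' : StrongDual 𝕜 Y →L[𝕜] ExtrapSpace hβ, T.IsDualObservation hT hβ C C' := by
  refine existsUnique_of_exists_of_unique ?_ fun C₁ C₂ h₁ h₂ => ?_
  · obtain ⟨S, hS⟩ := exists_shift_inverse (T.mem_resolventSet_of_dual hT hβ)
    let e := LinearIsometryEquiv.ofSurjective ((T.dual hT).resolventExtₗᵢ hβ)
      ((T.dual hT).resolventExt_surjective hβ)
    refine ⟨(e.symm.toContinuousLinearEquiv : StrongDual 𝕜 X →L[𝕜] ExtrapSpace hβ).comp
      (ContinuousLinearMap.precomp 𝕜 (C.comp S)), fun g x => ?_⟩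
    have h := e.apply_symm_apply (g.comp (C.comp S))
    refine (DFunLike.congr_fun h (DomSpace.shift T β x)).trans ?_
    change g (C (S (DomSpace.shift T β x))) = _
    rw [hS]
  · ext1 g
    apply T.pairExtrapDom_injective hT hβ
    ext x
    rw [h₁, h₂]

end Pairing

end C0Semigroup

/-! ### The `Δ₂`-condition and dominated convergence in Orlicz spaces -/

section DeltaTwo

variable {Ω : Type*} [MeasurableSpace Ω] {μ : Measure Ω} {Φ : ℝ → ℝ}
  {E F : Type*} [NormedAddCommGroup E] [NormedAddCommGroup F]

/-- Under the `Δ₂`-condition the modulars of a function in `L_Φ` are finite at every scale. -/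
theorem IsYoungFunction.orliczModular_lt_top_of_deltaTwo [IsFiniteMeasure μ]
    (hΦ : IsYoungFunction Φ) (hΔ : DeltaTwoInfinity Φ) {u : Ω → E} (hu : MemOrlicz Φ μ u) {k : ℝ}
    (hk : 0 < k) : orliczModular Φ μ k u < ∞ := by
  obtain ⟨K, t₀, hK, ht₀, h⟩ := hΔ
  obtain ⟨-, l, hl, hm⟩ := hu
  have key : ∀ t, 0 ≤ t → Φ (2 * t) ≤ K * Φ t + Φ (2 * t₀) := fun t ht => by
    rcases le_total t₀ t with h1 | h1
    · have := h t h1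
      linarith [hΦ.nonneg (mul_nonneg zero_le_two ht₀)]
    · have := hΦ.mono (mul_nonneg zero_le_two ht) (mul_le_mul_of_nonneg_left h1 zero_le_two)
      linarith [mul_nonneg hK (hΦ.nonneg ht)]
  have step : ∀ r, 0 < r → orliczModular Φ μ r u < ∞ → orliczModular Φ μ (r / 2) u < ∞ := by
    intro r hr hru
    have hle : ∀ ω, ENNReal.ofReal (Φ (‖u ω‖ / (r / 2))) ≤
        ENNReal.ofReal K * ENNReal.ofReal (Φ (‖u ω‖ / r)) + ENNReal.ofReal (Φ (2 * t₀)) := by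
      intro ω
      have h1 : 0 ≤ ‖u ω‖ / r := by positivity
      rw [← ENNReal.ofReal_mul hK, ← ENNReal.ofReal_add (mul_nonneg hK (hΦ.nonneg h1))
        (hΦ.nonneg (mul_nonneg zero_le_two ht₀))]
      refine ENNReal.ofReal_le_ofReal (le_trans (le_of_eq ?_) (key _ h1))
      congr 1
      field_simp
    refine (lintegral_mono hle).trans_lt ?_
    rw [lintegral_add_right _ measurable_const, lintegral_const_mul' _ _ ENNReal.ofReal_ne_top,
      lintegral_const]
    exact ENNReal.add_lt_top.2 ⟨ENNReal.mul_lt_top ENNReal.ofReal_lt_top hru,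
      ENNReal.mul_lt_top ENNReal.ofReal_lt_top (measure_lt_top _ _)⟩
  have hpow : ∀ n : ℕ, orliczModular Φ μ (l / 2 ^ n) u < ∞ := fun n => by
    induction n with
    | zero => simpa using hm
    | succ n ih =>
      have := step _ (by positivity) ih
      rwa [div_div, ← pow_succ] at this
  obtain ⟨n, hn⟩ := pow_unbounded_of_one_lt (l / k) one_lt_two
  have hn' : l / 2 ^ n ≤ k := by
    rw [div_lt_iff₀ hk] at hn
    rw [div_le_iff₀ (by positivity)]
    linarith
  exact (hΦ.orliczModular_mono (by positivity) hn' fun _ => le_rfl).trans_lt (hpow n)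

/-- Dominated convergence for the Luxemburg norm, when all modulars of the bound are finite. -/
theorem IsYoungFunction.tendsto_luxemburgNorm_zero (hΦ : IsYoungFunction Φ) {g : Ω → F}
    (hg : ∀ k, 0 < k → orliczModular Φ μ k g < ∞) {d : ℕ → Ω → E}
    (hd : ∀ n, AEStronglyMeasurable (d n) μ) (hdg : ∀ n ω, ‖d n ω‖ ≤ ‖g ω‖)
    (hlim : ∀ᵐ ω ∂μ, Tendsto (fun n => d n ω) atTop (𝓝 0)) :
    Tendsto (fun n => luxemburgNorm Φ μ (d n)) atTop (𝓝 0) := by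
  refine ENNReal.tendsto_nhds_zero.2 fun ε hε => ?_
  obtain ⟨k, hk0, hkε⟩ := ENNReal.lt_iff_exists_nnreal_btwn.1 hε
  have hk : (0 : ℝ) < k := by exact_mod_cast hk0
  have h1 : Tendsto (fun n => orliczModular Φ μ k (d n)) atTop (𝓝 (∫⁻ _, 0 ∂μ)) := by
    refine tendsto_lintegral_of_dominated_convergence'
      (fun ω => ENNReal.ofReal (Φ (‖g ω‖ / k))) (fun n => hΦ.aemeasurable_modular hk (hd n))
      (fun n => Eventually.of_forall fun ω => ENNReal.ofReal_le_ofReal <|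
        hΦ.mono (by positivity) (div_le_div_of_nonneg_right (hdg n ω) hk.le)) (hg k hk).ne ?_
    filter_upwards [hlim] with ω hω
    have h2 := (ENNReal.continuous_ofReal.comp hΦ.continuous_comp_max).tendsto 0
    have h3 : Tendsto (fun n => ‖d n ω‖ / (k : ℝ)) atTop (𝓝 0) := by
      simpa using hω.norm.div_const (k : ℝ)
    have h4 := h2.comp h3
    simp only [Function.comp_def, max_self, hΦ.map_zero, ENNReal.ofReal_zero] at h4
    refine h4.congr fun n => ?_
    rw [max_eq_left (by positivity)]
  rw [lintegral_zero] at h1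
  filter_upwards [h1.eventually_le_const one_pos] with n hn
  refine (luxemburgNorm_le hk hn).trans ?_
  rw [ENNReal.ofReal_coe_nnreal]
  exact hkε.le

end DeltaTwo

/-! ### Invariance under time reversal -/

section Reversal

variable {𝕜 : Type*} [RCLike 𝕜] {Φ : ℝ → ℝ} {E : Type*} [NormedAddCommGroup E] {τ : ℝ}

theorem measurePreserving_sub_lebesgueUpTo (τ : ℝ) :
    MeasurePreserving (fun s => τ - s) (lebesgueUpTo τ) (lebesgueUpTo τ) := by
  have h := (Measure.measurePreserving_sub_left volume τ).restrict_preimage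
    (measurableSet_Ioo (a := 0) (b := τ))
  have h1 : (fun s => τ - s) ⁻¹' Ioo 0 τ = Ioo 0 τ := by
    ext s
    simp [and_comm]
  rwa [h1] at h

theorem lintegral_comp_sub (f : ℝ → ℝ≥0∞) :
    ∫⁻ s, f (τ - s) ∂(lebesgueUpTo τ) = ∫⁻ s, f s ∂(lebesgueUpTo τ) :=
  (measurePreserving_sub_lebesgueUpTo τ).lintegral_comp_emb
    (MeasurableEquiv.subLeft τ).measurableEmbedding f

theorem luxemburgNorm_comp_sub (f : ℝ → E) :
    luxemburgNorm Φ (lebesgueUpTo τ) (fun s => f (τ - s)) = luxemburgNorm Φ (lebesgueUpTo τ) f := by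
  unfold luxemburgNorm orliczModular
  refine iInf_congr fun k => iInf_congr fun _ => ?_
  rw [lintegral_comp_sub (fun s => ENNReal.ofReal (Φ (‖f s‖ / k)))]

theorem orliczNorm_comp_sub_le [NormedSpace 𝕜 E] (f : ℝ → E) :
    orliczNorm 𝕜 Φ (lebesgueUpTo τ) (fun s => f (τ - s)) ≤
      orliczNorm 𝕜 Φ (lebesgueUpTo τ) f := by
  refine iSup_le fun g => iSup_le fun hg => iSup_le fun h1 => ?_
  refine le_trans (le_of_eq ?_) (lintegral_le_orliczNorm (g := fun s => g (τ - s))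
    (hg.comp_measurePreserving (measurePreserving_sub_lebesgueUpTo τ))
    ((luxemburgNorm_comp_sub g).trans_le h1))
  rw [← lintegral_comp_sub]
  simp only [sub_sub_cancel]

theorem orliczNorm_comp_sub [NormedSpace 𝕜 E] (f : ℝ → E) :
    orliczNorm 𝕜 Φ (lebesgueUpTo τ) (fun s => f (τ - s)) = orliczNorm 𝕜 Φ (lebesgueUpTo τ) f := by
  refine le_antisymm (orliczNorm_comp_sub_le f) ?_
  have := orliczNorm_comp_sub_le (𝕜 := 𝕜) (Φ := Φ) (τ := τ) fun s => f (τ - s)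
  simpa only [sub_sub_cancel] using this

end Reversal

set_option maxSynthPendingDepth 4 in
/-- The canonical image of a Banach space in its bidual is closed under limits. -/
theorem NormedSpace.exists_inclusionInDoubleDual_eq {𝕜 X : Type*} [RCLike 𝕜]
    [NormedAddCommGroup X] [NormedSpace 𝕜 X] [CompleteSpace X]
    {z : ℕ → X} {ζ : StrongDual 𝕜 (StrongDual 𝕜 X)} {b : ℕ → ℝ}
    (h : ∀ᶠ n in atTop, ‖NormedSpace.inclusionInDoubleDual 𝕜 X (z n) - ζ‖ ≤ b n)
    (hb : Tendsto b atTop (𝓝 0)) : ∃ x, NormedSpace.inclusionInDoubleDual 𝕜 X x = ζ := by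
  have h1 : Tendsto (fun n => NormedSpace.inclusionInDoubleDual 𝕜 X (z n)) atTop (𝓝 ζ) := by
    rw [tendsto_iff_norm_sub_tendsto_zero]
    exact squeeze_zero' (Eventually.of_forall fun _ => norm_nonneg _) h hb
  have hc : IsClosed (range (NormedSpace.inclusionInDoubleDual 𝕜 X)) :=
    (NormedSpace.inclusionInDoubleDualLi 𝕜 (E := X)).isometry.isClosedEmbedding.isClosed_range
  exact hc.mem_of_tendsto h1 (Eventually.of_forall fun n => mem_range_self _)

namespace C0Semigroup

variable {𝕜 : Type*} [RCLike 𝕜] {X : Type*} [NormedAddCommGroup X] [NormedSpace 𝕜 X]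
  [CompleteSpace X]

/-! ### Inputs whose state lies in `X` -/

section Range

variable (T : C0Semigroup 𝕜 X) {β : 𝕜} {hβ : β ∈ T.resolventSet}
  {U : Type*} [NormedAddCommGroup U] [NormedSpace 𝕜 U] (B : U →L[𝕜] ExtrapSpace hβ)

/-- The input that is constant up to time `a` and then vanishes steers into `X`, since the integral
of an orbit belongs to the domain of the generator. -/
theorem inputMap_indicator_Iic_mem_range {τ : ℝ} (hτ : 0 < τ) (a : ℝ) (v : U) :
    T.inputMap B τ ((Iic a).indicator fun _ => v) ∈ range (T.incl hβ) := by
  let : NormedSpace ℝ X := NormedSpace.restrictScalars ℝ 𝕜 X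
  have : IsScalarTower ℝ 𝕜 X := RestrictScalars.isScalarTower ℝ 𝕜 X
  set y := T.resolventExt hβ (B v) with hy
  set c := max 0 (min a τ) with hc
  have hc0 : 0 ≤ c := le_max_left _ _
  have hcτ : c ≤ τ := max_le hτ.le (min_le_right _ _)
  have hcont : Continuous fun s : ℝ => T s.toNNReal y :=
    (T.continuous_orbit y).comp continuous_real_toNNReal
  have hint : T.resolventExt hβ (T.inputMap B τ ((Iic a).indicator fun _ => v)) =
      (∫ s in (0)..τ, T s.toNNReal y) - ∫ s in (0)..(τ - c), T s.toNNReal y := by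
    rw [resolventExt_inputMap, lebesgueUpTo]
    have h1 : ∀ s, T (τ - s).toNNReal (T.resolventExt hβ (B ((Iic a).indicator (fun _ => v) s))) =
        (Iic a).indicator (fun s => T (τ - s).toNNReal y) s := fun s => by
      by_cases hs : s ∈ Iic a
      · rw [indicator_of_mem hs, indicator_of_mem hs]
      · rw [indicator_of_notMem hs, indicator_of_notMem hs]
        simp
    simp only [h1]
    rw [setIntegral_indicator measurableSet_Iic]
    have h2 : (Ioo 0 τ ∩ Iic a : Set ℝ) =ᵐ[volume] Ioc 0 c := by
      filter_upwards [compl_mem_ae_iff.2 (measure_singleton τ)] with s hs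
      have hs : s ≠ τ := hs
      refine propext ⟨fun h => ⟨h.1.1, le_max_of_le_right (le_min h.2 h.1.2.le)⟩, fun h => ?_⟩
      have h3 : s ≤ min a τ := (le_max_iff.1 h.2).resolve_left (not_le.2 h.1)
      exact ⟨⟨h.1, lt_of_le_of_ne (h3.trans (min_le_right _ _)) hs⟩, h3.trans (min_le_left _ _)⟩
    rw [setIntegral_congr_set h2, ← intervalIntegral.integral_of_le hc0,
      intervalIntegral.integral_comp_sub_left (fun s => T s.toNNReal y), sub_zero,
      intervalIntegral.integral_interval_sub_left (hcont.intervalIntegrable _ _)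
        (hcont.intervalIntegrable _ _)]
  obtain ⟨z₁, hz₁, -⟩ := (T.hasOrbitDeriv_integral y hτ.le).exists_domSpace
  obtain ⟨z₂, hz₂, -⟩ := (T.hasOrbitDeriv_integral y (sub_nonneg.2 hcτ)).exists_domSpace
  exact T.exists_incl_eq_of_resolventExt hβ (z := z₁ - z₂)
    (by rw [hint, map_sub (DomSpace.val T), hz₁, hz₂])

end Range

section Bidual

variable (T : C0Semigroup 𝕜 X) (hT : ∀ f : StrongDual 𝕜 X, Continuous fun t : ℝ≥0 => f.comp (T t))
  {β : 𝕜} {hβ : β ∈ T.resolventSet}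

/-- An element of `X₋₁` whose pairing with `X₁ᵈ` is bounded for the norm of `X'` is represented by
an element of the bidual of `X`. -/
theorem exists_bidual_of_pairDomExtrap_le {w : ExtrapSpace hβ} {K : ℝ} (hK : 0 ≤ K)
    (h : ∀ f, ‖T.pairDomExtrap hT hβ f w‖ ≤ K * ‖DomSpace.val (T.dual hT) f‖) :
    ∃ ζ : StrongDual 𝕜 (StrongDual 𝕜 X), ‖ζ‖ ≤ K ∧
      ∀ f, ζ (DomSpace.val (T.dual hT) f) = T.pairDomExtrap hT hβ f w :=
  (T.dual hT).exists_strongDual_extension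
    ((ContinuousLinearMap.apply 𝕜 𝕜 w).comp (T.pairDomExtrap hT hβ)).toLinearMap hK h

/-- An element of `X₋₁` represented by an element of `X` in the bidual lies in `X`. -/
theorem incl_eq_of_bidual {w : ExtrapSpace hβ} {ζ : StrongDual 𝕜 (StrongDual 𝕜 X)}
    (hζ : ∀ f, ζ (DomSpace.val (T.dual hT) f) = T.pairDomExtrap hT hβ f w) {z : X}
    (hz : NormedSpace.inclusionInDoubleDual 𝕜 X z = ζ) : T.incl hβ z = w := by
  refine T.extrap_ext_of_pairDomExtrap hT fun f => ?_
  rw [pairDomExtrap_incl, ← hζ, ← hz]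
  rfl

variable {U : Type*} [NormedAddCommGroup U] [NormedSpace 𝕜 U] (B : U →L[𝕜] ExtrapSpace hβ)
  {Φ : ℝ → ℝ} {τ K : ℝ}

/-- The inputs that steer into `X` are closed under convergence in Luxemburg norm, when the pairing
with `X₁ᵈ` is bounded: their states converge in the bidual, in which `X` is closed. -/
theorem inputMap_mem_range_of_tendsto (hΦ : IsYoungFunction Φ) (hK : 0 ≤ K)
    (hB : ∀ u : ℝ → U, MemOrlicz Φ (lebesgueUpTo τ) u → ∀ f,
      ‖T.pairDomExtrap hT hβ f (T.inputMap B τ u)‖ ≤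
        K * (luxemburgNorm Φ (lebesgueUpTo τ) u).toReal * ‖DomSpace.val (T.dual hT) f‖)
    {u : ℝ → U} (hu : MemOrlicz Φ (lebesgueUpTo τ) u) {v : ℕ → ℝ → U}
    (hv : ∀ n, Integrable (v n) (lebesgueUpTo τ))
    (hvr : ∀ n, T.inputMap B τ (v n) ∈ range (T.incl hβ))
    (hlim : Tendsto (fun n => luxemburgNorm Φ (lebesgueUpTo τ) fun s => v n s - u s) atTop (𝓝 0)) :
    T.inputMap B τ u ∈ range (T.incl hβ) := by
  have hui := hΦ.integrable_of_memOrlicz hu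
  obtain ⟨ζ, -, hζ⟩ := T.exists_bidual_of_pairDomExtrap_le hT
    (mul_nonneg hK ENNReal.toReal_nonneg) (hB u hu)
  choose z hz using hvr
  have h1 : ∀ᶠ n in atTop, ‖NormedSpace.inclusionInDoubleDual 𝕜 X (z n) - ζ‖ ≤
      K * (luxemburgNorm Φ (lebesgueUpTo τ) fun s => v n s - u s).toReal := by
    filter_upwards [hlim.eventually_lt_const ENNReal.zero_lt_top] with n hn
    refine (T.dual hT).opNorm_le_of_forall (mul_nonneg hK ENNReal.toReal_nonneg) fun f => ?_
    have h2 := hB (fun s => v n s - u s)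
      (memOrlicz_of_luxemburgNorm_lt_top ((hv n).sub hui).1 hn) f
    rw [T.inputMap_sub B (hv n) hui, map_sub, ← hζ, ← hz, pairDomExtrap_incl] at h2
    exact h2
  have h3 := ((ENNReal.tendsto_toReal ENNReal.zero_ne_top).comp hlim).const_mul K
  rw [ENNReal.toReal_zero, mul_zero] at h3
  obtain ⟨x, hx⟩ := NormedSpace.exists_inclusionInDoubleDual_eq h1 h3
  exact ⟨x, T.incl_eq_of_bidual hT hζ hx⟩

/-- Under the `Δ₂`-condition every input steers into `X`, when the pairing with `X₁ᵈ` is bounded: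
simple functions do, and they are dense in `L_Φ`. -/
theorem inputMap_mem_range_of_deltaTwo (hΦ : IsYoungFunction Φ) (hΔ : DeltaTwoInfinity Φ)
    (hτ : 0 < τ) (hK : 0 ≤ K)
    (hB : ∀ u : ℝ → U, MemOrlicz Φ (lebesgueUpTo τ) u → ∀ f,
      ‖T.pairDomExtrap hT hβ f (T.inputMap B τ u)‖ ≤
        K * (luxemburgNorm Φ (lebesgueUpTo τ) u).toReal * ‖DomSpace.val (T.dual hT) f‖)
    {u : ℝ → U} (hu : MemOrlicz Φ (lebesgueUpTo τ) u) :
    T.inputMap B τ u ∈ range (T.incl hβ) := by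
  set μ := lebesgueUpTo τ with hμ
  have hconst : ∀ v : U, MemOrlicz Φ μ fun _ : ℝ => v := fun v =>
    hΦ.memOrlicz_of_bound aestronglyMeasurable_const ‖v‖ (Eventually.of_forall fun _ => le_rfl)
  have hind : ∀ {s : Set ℝ}, MeasurableSet s → ∀ v : U,
      Integrable (s.indicator fun _ => v) μ := fun hs v => (integrable_const v).indicator hs
  have hsub : ∀ {v w : ℝ → U}, Integrable v μ → Integrable w μ →
      T.inputMap B τ v ∈ range (T.incl hβ) → T.inputMap B τ w ∈ range (T.incl hβ) →
      T.inputMap B τ (fun s => v s - w s) ∈ range (T.incl hβ) := by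
    rintro v w hv hw ⟨x, hx⟩ ⟨y, hy⟩
    exact ⟨x - y, by rw [map_sub, hx, hy, T.inputMap_sub B hv hw]⟩
  have hadd : ∀ {v w : ℝ → U}, Integrable v μ → Integrable w μ →
      T.inputMap B τ v ∈ range (T.incl hβ) → T.inputMap B τ w ∈ range (T.incl hβ) →
      T.inputMap B τ (fun s => v s + w s) ∈ range (T.incl hβ) := by
    rintro v w hv hw ⟨x, hx⟩ ⟨y, hy⟩
    exact ⟨x + y, by rw [_root_.map_add, hx, hy, T.inputMap_add B hv hw]⟩
  -- the measurable sets whose indicator inputs steer into `X` form a Dynkin system that contains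
  -- the half-lines `Iic a`
  have hset : ∀ s : Set ℝ, MeasurableSet s → ∀ v : U,
      T.inputMap B τ (s.indicator fun _ => v) ∈ range (T.incl hβ) := by
    intro s hs
    induction s, hs using MeasurableSpace.induction_on_inter (borel_eq_generateFrom_Iic ℝ)
      isPiSystem_Iic with
    | empty => exact fun v => ⟨0, by simp [inputMap]⟩
    | basic t ht =>
      obtain ⟨a, rfl⟩ := ht
      exact T.inputMap_indicator_Iic_mem_range B hτ a
    | compl t ht ih =>
      intro v
      -- on `(0, τ)` the complement is a difference of indicators, with `Iic τ` as the whole space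
      have h1 := hsub (hind measurableSet_Iic v) (hind ht v)
        (T.inputMap_indicator_Iic_mem_range B hτ τ v) (ih v)
      rwa [T.inputMap_congr B (v := tᶜ.indicator fun _ => v)] at h1
      filter_upwards [ae_restrict_mem measurableSet_Ioo] with s hs
      have h2 : s ∈ Iic τ := hs.2.le
      by_cases h3 : s ∈ t <;> simp [h2, h3]
    | iUnion A hA hAm ih =>
      intro v
      set S : ℕ → Set ℝ := fun n => ⋃ k < n, A k with hS
      have hSm : ∀ n, MeasurableSet (S n) := fun n =>
        MeasurableSet.iUnion fun k => MeasurableSet.iUnion fun _ => hAm k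
      have hSA : ∀ n, S n ⊆ ⋃ k, A k := fun n => iUnion₂_subset fun k _ => subset_iUnion A k
      have hSmono : Monotone S := fun m n hmn =>
        biUnion_subset_biUnion_left fun k (hk : k < m) => hk.trans_le hmn
      have hSU : ⋃ n, S n = ⋃ k, A k :=
        (iUnion_subset hSA).antisymm (iUnion_subset fun k => subset_iUnion_of_subset (k + 1)
          (subset_biUnion_of_mem (u := A) (show k < k + 1 from k.lt_succ_self)))
      have hSr : ∀ n, T.inputMap B τ ((S n).indicator fun _ => v) ∈ range (T.incl hβ) := by
        intro n
        induction n with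
        | zero => exact ⟨0, by simp [inputMap, hS]⟩
        | succ n ihn =>
          have h1 := hadd (hind (hSm n) v) (hind (hAm n) v) ihn (ih n v)
          have h2 : S (n + 1) = S n ∪ A n := biUnion_lt_succ A n
          have h3 : Disjoint (S n) (A n) := by
            refine disjoint_iUnion₂_left.2 fun k hk => hA hk.ne
          rw [h2, indicator_union_of_disjoint h3]
          exact h1
      refine T.inputMap_mem_range_of_tendsto hT B hΦ hK hB
        (v := fun n => (S n).indicator fun _ => v)
        (hΦ.memOrlicz_of_bound (hind (MeasurableSet.iUnion hAm) v).1 ‖v‖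
          (Eventually.of_forall fun s => norm_indicator_le_norm_self (fun _ => v) s))
        (fun n => hind (hSm n) v) hSr ?_
      refine hΦ.tendsto_luxemburgNorm_zero (g := fun _ => v)
        (fun k hk => hΦ.orliczModular_lt_top_of_deltaTwo hΔ (hconst v) hk)
        (fun n => ((hind (hSm n) v).sub (hind (MeasurableSet.iUnion hAm) v)).1) (fun n s => ?_)
        (Eventually.of_forall fun s => ?_)
      · by_cases h1 : s ∈ S n
        · simp [h1, hSA n h1]
        · by_cases h2 : s ∈ ⋃ k, A k <;> simp [h1, h2]
      · have h1 := (hSmono.tendsto_indicator S (fun _ => v) s).mono_right (pure_le_nhds _)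
        rw [hSU] at h1
        simpa using h1.sub_const ((⋃ k, A k).indicator (fun _ => v) s)
  have hsimple : ∀ f : SimpleFunc ℝ U, T.inputMap B τ f ∈ range (T.incl hβ) := by
    intro f
    induction f using SimpleFunc.induction with
    | @const c s hs =>
      have h1 : ⇑(SimpleFunc.piecewise s hs (.const ℝ c) (.const ℝ 0)) =
          s.indicator fun _ => c := by
        ext t
        by_cases ht : t ∈ s <;> simp [ht]
      exact h1 ▸ hset s hs c
    | add hd h1 h2 =>
      exact hadd (SimpleFunc.integrable_of_isFiniteMeasure _)
        (SimpleFunc.integrable_of_isFiniteMeasure _) h1 h2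
  -- approximate a representative `w` of `u` by simple functions `f n` with `‖f n - w‖ ≤ ‖w‖`
  have hw := hu.1.stronglyMeasurable_mk
  set w := hu.1.mk u
  have huw : u =ᵐ[μ] w := hu.1.ae_eq_mk
  have hwm : MemOrlicz Φ μ w := by
    have ⟨_, k, hk, hm⟩ := hu
    refine ⟨hw.aestronglyMeasurable, k, hk, ?_⟩
    have h1 : orliczModular Φ μ k w = orliczModular Φ μ k u :=
      lintegral_congr_ae (huw.mono fun s hs => by simp only [hs])
    rwa [h1]
  rw [T.inputMap_congr B huw]
  borelize U
  have := hw.separableSpace_range_union_singleton (b := 0)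
  have h0 : (0 : U) ∈ range w ∪ {0} := by simp
  set f : ℕ → SimpleFunc ℝ U := SimpleFunc.approxOn w hw.measurable (range w ∪ {0}) 0 h0
  have hfw : ∀ n s, ‖f n s - w s‖ ≤ ‖w s‖ := fun n s => by
    have h1 := SimpleFunc.edist_approxOn_le hw.measurable h0 s n
    rwa [edist_comm 0, edist_zero_right, edist_eq_enorm_sub, enorm_le_iff_norm_le] at h1
  refine T.inputMap_mem_range_of_tendsto hT B hΦ hK hB hwm (v := fun n => f n)
    (fun n => SimpleFunc.integrable_of_isFiniteMeasure _) (fun n => hsimple (f n)) ?_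
  refine hΦ.tendsto_luxemburgNorm_zero
    (fun k hk => hΦ.orliczModular_lt_top_of_deltaTwo hΔ hwm hk)
    (fun n => (f n).aestronglyMeasurable.sub hw.aestronglyMeasurable) hfw
    (Eventually.of_forall fun s => ?_)
  have h1 : Tendsto (fun n => f n s) atTop (𝓝 (w s)) :=
    SimpleFunc.tendsto_approxOn hw.measurable h0 (subset_closure (by simp))
  simpa using h1.sub_const (w s)

end Bidual

end C0Semigroup

/-! ### Comparison of constants -/

section Constants

/-- Infima in `[0, ∞]` may be compared on finite elements. For the constant `b = ∞` the convention
`∞ * 0 = 0` would make the admissibility bounds a genuine condition. -/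
theorem ENNReal.sInf_congr_of_ne_top {S S' : Set ℝ≥0∞} (h : ∀ b ≠ ∞, b ∈ S ↔ b ∈ S') :
    sInf S = sInf S' := by
  have key : ∀ {A B : Set ℝ≥0∞}, (∀ b ≠ ∞, b ∈ A ↔ b ∈ B) → sInf A ≤ sInf B := fun hAB => by
    refine le_sInf fun b hb => ?_
    rcases eq_or_ne b ∞ with rfl | hb'
    · exact le_top
    · exact sInf_le ((hAB b hb').2 hb)
  exact (key h).antisymm (key fun b hb => (h b hb).symm)

theorem enorm_le_mul_enorm_iff {E F : Type*} [NormedAddCommGroup E] [NormedAddCommGroup F]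
    {a : ℝ≥0∞} (ha : a ≠ ∞) {x : E} {y : F} : ‖x‖ₑ ≤ a * ‖y‖ₑ ↔ ‖x‖ ≤ a.toReal * ‖y‖ := by
  rw [← ofReal_norm, ← ofReal_norm, ← ENNReal.ofReal_toReal ha,
    ← ENNReal.ofReal_mul ENNReal.toReal_nonneg, ENNReal.ofReal_toReal ha,
    ENNReal.ofReal_le_ofReal_iff (by positivity)]

theorem exists_lt_top_of_le_two_mul {a b : ℝ → ℝ≥0∞} (h : ∀ τ, 0 < τ → a τ ≤ 2 * b τ)
    (hb : ∃ τ, 0 < τ ∧ b τ < ∞) : ∃ τ, 0 < τ ∧ a τ < ∞ := by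
  obtain ⟨τ, hτ, hb⟩ := hb
  exact ⟨τ, hτ, (h τ hτ).trans_lt (ENNReal.mul_lt_top (by simp) hb)⟩

theorem iSup_lt_top_of_le_two_mul {a b : ℝ → ℝ≥0∞} (h : ∀ τ, 0 < τ → a τ ≤ 2 * b τ)
    (hb : ⨆ (τ : ℝ) (_ : 0 < τ), b τ < ∞) : ⨆ (τ : ℝ) (_ : 0 < τ), a τ < ∞ := by
  refine lt_of_le_of_lt ?_ (ENNReal.mul_lt_top (a := 2) (by simp) hb)
  refine iSup₂_le fun τ hτ => (h τ hτ).trans ?_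
  gcongr
  exact le_iSup₂ (f := fun (τ : ℝ) (_ : 0 < τ) => b τ) τ hτ

end Constants

/-! ### Norms of functions as norms of integral functionals -/

namespace IsYoungFunction

variable {𝕜 : Type*} [RCLike 𝕜] {Ω : Type*} [MeasurableSpace Ω] {μ : Measure Ω}
  [IsFiniteMeasure μ] {Φ : ℝ → ℝ} {Y : Type*} [NormedAddCommGroup Y] [NormedSpace 𝕜 Y]
  (hΦ : IsYoungFunction Φ) {f : Ω → Y} (hf : AEStronglyMeasurable f μ)
  (hfb : ∃ M, ∀ᵐ ω ∂μ, ‖f ω‖ ≤ M)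
include hΦ

omit [IsFiniteMeasure μ] in
theorem orliczNorm_complementary_complementary (f : Ω → Y) :
    orliczNorm 𝕜 (complementaryYoung (complementaryYoung Φ)) μ f = orliczNorm 𝕜 Φ μ f := by
  unfold orliczNorm
  refine iSup_congr fun g => iSup_congr fun _ => ?_
  rw [hΦ.complementary.luxemburgNorm_complementary_complementary]

omit [IsFiniteMeasure μ] in
theorem luxemburgNorm_inclusionInDoubleDual (f : Ω → Y) :
    luxemburgNorm (complementaryYoung (complementaryYoung Φ)) μ
      (fun ω => NormedSpace.inclusionInDoubleDual 𝕜 Y (f ω)) = luxemburgNorm Φ μ f := by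
  rw [hΦ.luxemburgNorm_complementary_complementary]
  have hJ : ∀ y : Y, ‖NormedSpace.inclusionInDoubleDual 𝕜 Y y‖ = ‖y‖ :=
    (NormedSpace.inclusionInDoubleDualLi 𝕜 (E := Y)).norm_map
  exact (hΦ.luxemburgNorm_mono fun ω => (hJ (f ω)).le).antisymm
    (hΦ.luxemburgNorm_mono fun ω => (hJ (f ω)).ge)

omit [IsFiniteMeasure μ] in
theorem orliczNorm_inclusionInDoubleDual' (f : Ω → Y) :
    orliczNorm 𝕜 (complementaryYoung (complementaryYoung Φ)) μ
      (fun ω => NormedSpace.inclusionInDoubleDual 𝕜 Y (f ω)) = orliczNorm 𝕜 Φ μ f := by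
  rw [hΦ.orliczNorm_complementary_complementary, orliczNorm_inclusionInDoubleDual hΦ]

omit hΦ [IsFiniteMeasure μ] in
include hf in
theorem aestronglyMeasurable_inclusionInDoubleDual :
    AEStronglyMeasurable (fun ω => NormedSpace.inclusionInDoubleDual 𝕜 Y (f ω)) μ :=
  (NormedSpace.inclusionInDoubleDual 𝕜 Y).continuous.comp_aestronglyMeasurable hf

omit hΦ [IsFiniteMeasure μ] in
include hfb in
theorem exists_bound_inclusionInDoubleDual :
    ∃ M, ∀ᵐ ω ∂μ, ‖NormedSpace.inclusionInDoubleDual 𝕜 Y (f ω)‖ ≤ M := by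
  obtain ⟨M, hM⟩ := hfb
  exact ⟨M, hM.mono fun ω hω => (NormedSpace.double_dual_bound 𝕜 Y (f ω)).trans hω⟩

include hf hfb

set_option maxSynthPendingDepth 4 in
/-- The Orlicz norm of `f` as a norm of a functional on dual-valued functions; `f` is regarded as a
function with values in the bidual. -/
theorem orliczNorm_le_iff_predual {b : ℝ≥0∞} :
    orliczNorm 𝕜 Φ μ f ≤ b ↔ ∀ u : Ω → StrongDual 𝕜 Y, MemOrlicz (complementaryYoung Φ) μ u →
      ‖∫ ω, u ω (f ω) ∂μ‖ₑ ≤ b * luxemburgNorm (complementaryYoung Φ) μ u := by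
  have h := hΦ.complementary.orliczNorm_le_iff (b := b)
    (aestronglyMeasurable_inclusionInDoubleDual (𝕜 := 𝕜) hf)
    (exists_bound_inclusionInDoubleDual (𝕜 := 𝕜) hfb)
  simp only [NormedSpace.dual_def] at h
  rwa [hΦ.orliczNorm_inclusionInDoubleDual' f] at h

set_option maxSynthPendingDepth 4 in
/-- The Luxemburg norm of `f` as a norm of a functional on dual-valued functions. -/
theorem luxemburgNorm_le_iff_predual {b : ℝ≥0∞} :
    luxemburgNorm Φ μ f ≤ b ↔ ∀ u : Ω → StrongDual 𝕜 Y, MemOrlicz (complementaryYoung Φ) μ u →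
      ‖∫ ω, u ω (f ω) ∂μ‖ₑ ≤ b * orliczNorm 𝕜 (complementaryYoung Φ) μ u := by
  have h := hΦ.complementary.luxemburgNorm_le_iff (b := b)
    (aestronglyMeasurable_inclusionInDoubleDual (𝕜 := 𝕜) hf)
    (exists_bound_inclusionInDoubleDual (𝕜 := 𝕜) hfb)
  simp only [NormedSpace.dual_def] at h
  rwa [hΦ.luxemburgNorm_inclusionInDoubleDual f] at h

theorem luxemburgNorm_le_orliczNorm_of_bound :
    luxemburgNorm Φ μ f ≤ orliczNorm 𝕜 Φ μ f := by
  rw [← hΦ.luxemburgNorm_inclusionInDoubleDual (𝕜 := 𝕜),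
    ← hΦ.orliczNorm_inclusionInDoubleDual' (𝕜 := 𝕜)]
  exact hΦ.complementary.luxemburgNorm_le_orliczNorm
    (aestronglyMeasurable_inclusionInDoubleDual hf) (exists_bound_inclusionInDoubleDual hfb)

end IsYoungFunction

/-! ### Duality of admissibility -/

namespace C0Semigroup

variable {𝕜 : Type*} [RCLike 𝕜] {X : Type*} [NormedAddCommGroup X] [NormedSpace 𝕜 X]

section Output

variable (T : C0Semigroup 𝕜 X) {Y : Type*} [NormedAddCommGroup Y] [NormedSpace 𝕜 Y]
  (C : T.DomSpace →L[𝕜] Y)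

theorem aestronglyMeasurable_output (x : T.DomSpace) (τ : ℝ) :
    AEStronglyMeasurable (fun s => T.output C x (τ - s)) (lebesgueUpTo τ) :=
  ((T.continuous_output C x).comp (continuous_const.sub continuous_id)).aestronglyMeasurable

theorem exists_output_bound (x : T.DomSpace) (τ : ℝ) :
    ∃ M, ∀ᵐ s ∂(lebesgueUpTo τ), ‖T.output C x (τ - s)‖ ≤ M := by
  obtain ⟨M, hM⟩ := (isCompact_Icc (a := (0 : ℝ)) (b := τ)).exists_bound_of_continuousOn
    (T.continuous_output C x).continuousOn
  refine ⟨M, (ae_restrict_mem measurableSet_Ioo).mono fun s hs => hM _ ⟨?_, ?_⟩⟩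
  · linarith [hs.2]
  · linarith [hs.1]

variable {Φ : ℝ → ℝ} (hΦ : IsYoungFunction Φ)
include hΦ

theorem luxemburgNorm_output_le_orliczNorm (x : T.DomSpace) (τ : ℝ) :
    luxemburgNorm Φ (lebesgueUpTo τ) (T.output C x) ≤
      orliczNorm 𝕜 Φ (lebesgueUpTo τ) (T.output C x) := by
  rw [← luxemburgNorm_comp_sub, ← orliczNorm_comp_sub]
  exact hΦ.luxemburgNorm_le_orliczNorm_of_bound (T.aestronglyMeasurable_output C x τ)
    (T.exists_output_bound C x τ)

theorem obsConst_luxemburgNorm_le (τ : ℝ) :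
    T.obsConst C (luxemburgNorm Φ) τ ≤ T.obsConst C (orliczNorm 𝕜 Φ) τ :=
  sInf_le_sInf fun _ hc x => (T.luxemburgNorm_output_le_orliczNorm C hΦ x τ).trans (hc x)

theorem obsConst_orliczNorm_le (τ : ℝ) :
    T.obsConst C (orliczNorm 𝕜 Φ) τ ≤ 2 * T.obsConst C (luxemburgNorm Φ) τ := by
  rw [mul_comm, ← ENNReal.div_le_iff_le_mul (by simp) (by simp)]
  refine le_sInf fun c hc => ?_
  rw [ENNReal.div_le_iff_le_mul (by simp) (by simp)]
  refine sInf_le fun x => (hΦ.orliczNorm_le_two_mul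
    (T.continuous_output C x).aestronglyMeasurable).trans ?_
  rw [mul_comm c, mul_assoc]
  exact mul_le_mul_right (hc x) 2

end Output

variable [CompleteSpace X] (T : C0Semigroup 𝕜 X)
  (hT : ∀ f : StrongDual 𝕜 X, Continuous fun t : ℝ≥0 => f.comp (T t)) {β : 𝕜} {Φ : ℝ → ℝ}

section Observation

variable {Y : Type*} [NormedAddCommGroup Y] [NormedSpace 𝕜 Y] {hβ : β ∈ (T.dual hT).resolventSet}
  {C : T.DomSpace →L[𝕜] Y} {C' : StrongDual 𝕜 Y →L[𝕜] ExtrapSpace hβ}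

/-- The control problem for `C'` is solved by extending the functional
`x ↦ ∫ ⟨u(s), C T(τ - s) x⟩ ds` from `D(A)` to `X`. -/
theorem ctrl_bound_iff_of_isDualObservation (hΦ : IsYoungFunction Φ)
    (hC : T.IsDualObservation hT hβ C C') (τ : ℝ) {N : (ℝ → StrongDual 𝕜 Y) → ℝ≥0∞}
    (hN : ∀ u, MemOrlicz Φ (lebesgueUpTo τ) u → N u ≠ ∞) {b : ℝ≥0∞} (hb : b ≠ ∞) :
    (∀ u, MemOrlicz Φ (lebesgueUpTo τ) u → ∃ z, (T.dual hT).incl hβ z =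
      (T.dual hT).inputMap C' τ u ∧ ‖z‖ₑ ≤ b * N u) ↔
    ∀ x, ∀ u : ℝ → StrongDual 𝕜 Y, MemOrlicz Φ (lebesgueUpTo τ) u →
      ‖∫ s, u s (T.output C x (τ - s)) ∂(lebesgueUpTo τ)‖ₑ ≤ b * ‖DomSpace.val T x‖ₑ * N u := by
  constructor
  · intro h x u hu
    obtain ⟨z, hz, hzb⟩ := h u hu
    rw [← T.pairExtrapDom_inputMap hT hC (hΦ.integrable_of_memOrlicz hu), ← hz, pairExtrapDom_incl,
      mul_right_comm]
    exact (z.le_opENorm _).trans (mul_le_mul_left hzb _)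
  · intro h u hu
    have hbN : b * N u ≠ ∞ := ENNReal.mul_ne_top hb (hN u hu)
    obtain ⟨z, hz, hzx⟩ := T.exists_strongDual_extension
      (T.pairExtrapDom hT hβ ((T.dual hT).inputMap C' τ u)).toLinearMap
      (K := (b * N u).toReal) ENNReal.toReal_nonneg fun x => by
        have h1 := h x u hu
        rw [mul_right_comm, enorm_le_mul_enorm_iff hbN,
          ← T.pairExtrapDom_inputMap hT hC (hΦ.integrable_of_memOrlicz hu)] at h1
        exact h1
    refine ⟨z, T.pairExtrapDom_injective hT hβ ?_, ?_⟩
    · ext x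
      rw [pairExtrapDom_incl, hzx]
      rfl
    · rw [← ofReal_norm]
      exact ENNReal.ofReal_le_of_le_toReal hz

theorem obsConst_orliczNorm_eq_ctrlConst (hΦ : IsYoungFunction Φ)
    (hC : T.IsDualObservation hT hβ C C') (τ : ℝ) :
    T.obsConst C (orliczNorm 𝕜 Φ) τ = (T.dual hT).ctrlConst C' (complementaryYoung Φ)
      (luxemburgNorm (complementaryYoung Φ)) τ := by
  refine ENNReal.sInf_congr_of_ne_top fun b hb => ?_
  refine Iff.trans ?_ (T.ctrl_bound_iff_of_isDualObservation hT hΦ.complementary hC τ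
    (fun u hu => (hΦ.complementary.luxemburgNorm_lt_top hu).ne) hb).symm
  refine forall_congr' fun x => ?_
  rw [← orliczNorm_comp_sub (𝕜 := 𝕜)]
  exact hΦ.orliczNorm_le_iff_predual (T.aestronglyMeasurable_output C x τ)
    (T.exists_output_bound C x τ)

theorem obsConst_luxemburgNorm_eq_ctrlConst (hΦ : IsYoungFunction Φ)
    (hC : T.IsDualObservation hT hβ C C') (τ : ℝ) :
    T.obsConst C (luxemburgNorm Φ) τ = (T.dual hT).ctrlConst C' (complementaryYoung Φ)
      (orliczNorm 𝕜 (complementaryYoung Φ)) τ := by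
  refine ENNReal.sInf_congr_of_ne_top fun b hb => ?_
  refine Iff.trans ?_ (T.ctrl_bound_iff_of_isDualObservation hT hΦ.complementary hC τ
    (fun u hu => hΦ.complementary.orliczNorm_ne_top_of_memOrlicz hu) hb).symm
  refine forall_congr' fun x => ?_
  rw [← luxemburgNorm_comp_sub]
  exact hΦ.luxemburgNorm_le_iff_predual (T.aestronglyMeasurable_output C x τ)
    (T.exists_output_bound C x τ)

end Observation

section Control

variable {U : Type*} [NormedAddCommGroup U] [NormedSpace 𝕜 U] {hβ : β ∈ T.resolventSet}
  {B : U →L[𝕜] ExtrapSpace hβ}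

/-- Pairing the state with `f ∈ X₁ᵈ` turns a bound for the control problem into one for the dual
observation. -/
theorem dual_bound_of_ctrl_bound (hΦ : IsYoungFunction Φ) (τ : ℝ) {N : (ℝ → U) → ℝ≥0∞}
    {b : ℝ≥0∞} (h : ∀ u, MemOrlicz Φ (lebesgueUpTo τ) u →
      ∃ z, T.incl hβ z = T.inputMap B τ u ∧ ‖z‖ₑ ≤ b * N u) (f : (T.dual hT).DomSpace)
    (u : ℝ → U) (hu : MemOrlicz Φ (lebesgueUpTo τ) u) :
    ‖∫ s, (T.dual hT).output (T.dualControl hT hβ B) f (τ - s) (u s) ∂(lebesgueUpTo τ)‖ₑ ≤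
      b * ‖DomSpace.val (T.dual hT) f‖ₑ * N u := by
  obtain ⟨z, hz, hzb⟩ := h u hu
  rw [← T.pairDomExtrap_inputMap hT B (hΦ.integrable_of_memOrlicz hu), ← hz, pairDomExtrap_incl,
    mul_right_comm, mul_comm]
  exact ((DomSpace.val (T.dual hT) f).le_opENorm z).trans (mul_le_mul_right hzb _)

/-- The state belongs to `X''`; it lies in `X` if `X` is reflexive, or by approximation if `Φ`
satisfies the `Δ₂`-condition. -/
theorem ctrl_bound_of_dual_bound (hΦ : IsYoungFunction Φ)
    (h : Function.Surjective (NormedSpace.inclusionInDoubleDual 𝕜 X) ∨ DeltaTwoInfinity Φ)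
    {τ : ℝ} (hτ : 0 < τ) {N : (ℝ → U) → ℝ≥0∞}
    (hN : ∀ u, MemOrlicz Φ (lebesgueUpTo τ) u → N u ≤ 2 * luxemburgNorm Φ (lebesgueUpTo τ) u)
    {b : ℝ≥0∞} (hb : b ≠ ∞)
    (hB : ∀ f, ∀ u, MemOrlicz Φ (lebesgueUpTo τ) u →
      ‖∫ s, (T.dual hT).output (T.dualControl hT hβ B) f (τ - s) (u s) ∂(lebesgueUpTo τ)‖ₑ ≤
        b * ‖DomSpace.val (T.dual hT) f‖ₑ * N u)
    (u : ℝ → U) (hu : MemOrlicz Φ (lebesgueUpTo τ) u) :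
    ∃ z, T.incl hβ z = T.inputMap B τ u ∧ ‖z‖ₑ ≤ b * N u := by
  have hNfin : ∀ u, MemOrlicz Φ (lebesgueUpTo τ) u → N u ≠ ∞ := fun u hu =>
    ((hN u hu).trans_lt (ENNReal.mul_lt_top (by simp) (hΦ.luxemburgNorm_lt_top hu))).ne
  have hpair : ∀ u, MemOrlicz Φ (lebesgueUpTo τ) u → ∀ f,
      ‖T.pairDomExtrap hT hβ f (T.inputMap B τ u)‖ ≤
        (b * N u).toReal * ‖DomSpace.val (T.dual hT) f‖ := fun u hu f => by
    have h1 := hB f u hu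
    rwa [mul_right_comm, enorm_le_mul_enorm_iff (ENNReal.mul_ne_top hb (hNfin u hu)),
      ← T.pairDomExtrap_inputMap hT B (hΦ.integrable_of_memOrlicz hu)] at h1
  have hrange : T.inputMap B τ u ∈ range (T.incl hβ) := by
    rcases h with h | h
    · obtain ⟨ζ, -, hζ⟩ := T.exists_bidual_of_pairDomExtrap_le hT ENNReal.toReal_nonneg
        (hpair u hu)
      obtain ⟨z, hz⟩ := h ζ
      exact ⟨z, T.incl_eq_of_bidual hT hζ hz⟩
    · refine T.inputMap_mem_range_of_deltaTwo hT B hΦ h hτ (K := (b * 2).toReal)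
        ENNReal.toReal_nonneg (fun v hv f => (hpair v hv f).trans ?_) hu
      refine mul_le_mul_of_nonneg_right ?_ (norm_nonneg _)
      rw [← ENNReal.toReal_mul, mul_assoc]
      refine ENNReal.toReal_mono (ENNReal.mul_ne_top hb (ENNReal.mul_ne_top (by simp)
        (hΦ.luxemburgNorm_lt_top hv).ne)) (mul_le_mul_right (hN v hv) b)
  obtain ⟨z, hz⟩ := hrange
  refine ⟨z, hz, ?_⟩
  rw [← ofReal_norm]
  refine ENNReal.ofReal_le_of_le_toReal ?_
  have hJ : ‖NormedSpace.inclusionInDoubleDual 𝕜 X z‖ = ‖z‖ :=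
    (NormedSpace.inclusionInDoubleDualLi 𝕜 (E := X)).norm_map z
  rw [← hJ]
  refine (T.dual hT).opNorm_le_of_forall ENNReal.toReal_nonneg fun f => ?_
  have h1 := hpair u hu f
  rw [← hz, pairDomExtrap_incl] at h1
  exact h1

theorem obsConst_dualControl_le (hΦ : IsYoungFunction Φ) (τ : ℝ) :
    (T.dual hT).obsConst (T.dualControl hT hβ B) (luxemburgNorm (complementaryYoung Φ)) τ ≤
      T.ctrlConst B Φ (luxemburgNorm Φ) τ := by
  refine le_sInf fun b hb => sInf_le fun f => ?_
  refine ((T.dual hT).luxemburgNorm_output_le_orliczNorm _ hΦ.complementary f τ).trans ?_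
  rw [← orliczNorm_comp_sub (𝕜 := 𝕜)]
  exact (hΦ.orliczNorm_le_iff ((T.dual hT).aestronglyMeasurable_output _ f τ)
    ((T.dual hT).exists_output_bound _ f τ)).2 (T.dual_bound_of_ctrl_bound hT hΦ τ hb f)

theorem obsConst_dualControl_orliczNorm_eq (hΦ : IsYoungFunction Φ)
    (h : Function.Surjective (NormedSpace.inclusionInDoubleDual 𝕜 X) ∨ DeltaTwoInfinity Φ)
    {τ : ℝ} (hτ : 0 < τ) :
    (T.dual hT).obsConst (T.dualControl hT hβ B) (orliczNorm 𝕜 (complementaryYoung Φ)) τ =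
      T.ctrlConst B Φ (luxemburgNorm Φ) τ := by
  refine ENNReal.sInf_congr_of_ne_top fun b hb => ?_
  refine Iff.trans ?_ ⟨T.ctrl_bound_of_dual_bound hT hΦ h hτ
    (fun u _ => le_mul_of_one_le_left' one_le_two) hb, T.dual_bound_of_ctrl_bound hT hΦ τ⟩
  refine forall_congr' fun f => ?_
  rw [← orliczNorm_comp_sub (𝕜 := 𝕜)]
  exact hΦ.orliczNorm_le_iff ((T.dual hT).aestronglyMeasurable_output _ f τ)
    ((T.dual hT).exists_output_bound _ f τ)

theorem obsConst_dualControl_luxemburgNorm_eq (hΦ : IsYoungFunction Φ)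
    (h : Function.Surjective (NormedSpace.inclusionInDoubleDual 𝕜 X) ∨ DeltaTwoInfinity Φ)
    {τ : ℝ} (hτ : 0 < τ) :
    (T.dual hT).obsConst (T.dualControl hT hβ B) (luxemburgNorm (complementaryYoung Φ)) τ =
      T.ctrlConst B Φ (orliczNorm 𝕜 Φ) τ := by
  refine ENNReal.sInf_congr_of_ne_top fun b hb => ?_
  refine Iff.trans ?_ ⟨T.ctrl_bound_of_dual_bound hT hΦ h hτ
    (fun u hu => hΦ.orliczNorm_le_two_mul hu.1) hb, T.dual_bound_of_ctrl_bound hT hΦ τ⟩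
  refine forall_congr' fun f => ?_
  rw [← luxemburgNorm_comp_sub]
  exact hΦ.luxemburgNorm_le_iff ((T.dual hT).aestronglyMeasurable_output _ f τ)
    ((T.dual hT).exists_output_bound _ f τ)

end Control

end C0Semigroup

theorem mainTheorem4 {𝕜 : Type*} [RCLike 𝕜]
    {X : Type*} [NormedAddCommGroup X] [NormedSpace 𝕜 X] [CompleteSpace X]
    {U : Type*} [NormedAddCommGroup U] [NormedSpace 𝕜 U] [CompleteSpace U]
    {Y : Type*} [NormedAddCommGroup Y] [NormedSpace 𝕜 Y] [CompleteSpace Y]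
    (T : C0Semigroup 𝕜 X)
    (hT : ∀ f : StrongDual 𝕜 X, Continuous fun t : ℝ≥0 => f.comp (T t))
    (Φ : ℝ → ℝ) (hΦ : IsYoungFunction Φ) :
    -- duality for observation operators
    (∀ (β : 𝕜) (hβ : β ∈ (T.dual hT).resolventSet) (C : T.DomSpace →L[𝕜] Y),
      (∃! C' : StrongDual 𝕜 Y →L[𝕜] C0Semigroup.ExtrapSpace hβ, T.IsDualObservation hT hβ C C') ∧
      ∀ C' : StrongDual 𝕜 Y →L[𝕜] C0Semigroup.ExtrapSpace hβ, T.IsDualObservation hT hβ C C' →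
        (T.IsAdmissibleObs Φ C ↔ (T.dual hT).IsAdmissibleCtrl (complementaryYoung Φ) C') ∧
        (T.IsInfAdmissibleObs Φ C ↔ (T.dual hT).IsInfAdmissibleCtrl (complementaryYoung Φ) C') ∧
        (∀ τ : ℝ, 0 < τ →
          T.obsConst C (orliczNorm 𝕜 Φ) τ =
            (T.dual hT).ctrlConst C' (complementaryYoung Φ)
              (luxemburgNorm (complementaryYoung Φ)) τ ∧
          T.obsConst C (luxemburgNorm Φ) τ =
            (T.dual hT).ctrlConst C' (complementaryYoung Φ)
              (orliczNorm 𝕜 (complementaryYoung Φ)) τ ∧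
          T.obsConst C (luxemburgNorm Φ) τ ≤
            (T.dual hT).ctrlConst C' (complementaryYoung Φ)
              (luxemburgNorm (complementaryYoung Φ)) τ ∧
          (T.dual hT).ctrlConst C' (complementaryYoung Φ)
              (luxemburgNorm (complementaryYoung Φ)) τ ≤
            2 * T.obsConst C (luxemburgNorm Φ) τ) ∧
        T.obsConstInf C (orliczNorm 𝕜 Φ) =
          (T.dual hT).ctrlConstInf C' (complementaryYoung Φ)
            (luxemburgNorm (complementaryYoung Φ)) ∧
        T.obsConstInf C (luxemburgNorm Φ) =
          (T.dual hT).ctrlConstInf C' (complementaryYoung Φ)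
            (orliczNorm 𝕜 (complementaryYoung Φ))) ∧
    -- duality for control operators
    (∀ (β : 𝕜) (hβ : β ∈ T.resolventSet) (B : U →L[𝕜] C0Semigroup.ExtrapSpace hβ),
      (T.IsAdmissibleCtrl Φ B →
        (T.dual hT).IsAdmissibleObs (complementaryYoung Φ) (T.dualControl hT hβ B)) ∧
      (T.IsInfAdmissibleCtrl Φ B →
        (T.dual hT).IsInfAdmissibleObs (complementaryYoung Φ) (T.dualControl hT hβ B)) ∧
      (∀ τ : ℝ, 0 < τ →
        (T.dual hT).obsConst (T.dualControl hT hβ B) (luxemburgNorm (complementaryYoung Φ)) τ ≤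
          T.ctrlConst B Φ (luxemburgNorm Φ) τ) ∧
      (T.dual hT).obsConstInf (T.dualControl hT hβ B) (luxemburgNorm (complementaryYoung Φ)) ≤
        T.ctrlConstInf B Φ (luxemburgNorm Φ) ∧
      -- the converse, and equality of the constants
      (Function.Surjective (NormedSpace.inclusionInDoubleDual 𝕜 X) ∨ DeltaTwoInfinity Φ →
        ((T.dual hT).IsAdmissibleObs (complementaryYoung Φ) (T.dualControl hT hβ B) →
          T.IsAdmissibleCtrl Φ B) ∧
        ((T.dual hT).IsInfAdmissibleObs (complementaryYoung Φ) (T.dualControl hT hβ B) →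
          T.IsInfAdmissibleCtrl Φ B) ∧
        (∀ τ : ℝ, 0 < τ →
          (T.dual hT).obsConst (T.dualControl hT hβ B)
              (orliczNorm 𝕜 (complementaryYoung Φ)) τ =
            T.ctrlConst B Φ (luxemburgNorm Φ) τ ∧
          (T.dual hT).obsConst (T.dualControl hT hβ B)
              (luxemburgNorm (complementaryYoung Φ)) τ =
            T.ctrlConst B Φ (orliczNorm 𝕜 Φ) τ ∧
          T.ctrlConst B Φ (luxemburgNorm Φ) τ ≤
            2 * (T.dual hT).obsConst (T.dualControl hT hβ B)
              (luxemburgNorm (complementaryYoung Φ)) τ) ∧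
        (T.dual hT).obsConstInf (T.dualControl hT hβ B)
            (orliczNorm 𝕜 (complementaryYoung Φ)) =
          T.ctrlConstInf B Φ (luxemburgNorm Φ) ∧
        (T.dual hT).obsConstInf (T.dualControl hT hβ B)
            (luxemburgNorm (complementaryYoung Φ)) =
          T.ctrlConstInf B Φ (orliczNorm 𝕜 Φ))) := by
  refine ⟨fun β hβ C => ⟨T.existsUnique_isDualObservation hT hβ C, fun C' hC => ?_⟩,
    fun β hβ B => ?_⟩
  · have e₁ := T.obsConst_orliczNorm_eq_ctrlConst hT hΦ hC
    have e₂ := T.obsConst_luxemburgNorm_eq_ctrlConst hT hΦ hC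
    have le₁ := fun τ => (T.obsConst_luxemburgNorm_le C hΦ τ).trans_eq (e₁ τ)
    have le₂ := fun τ => (e₁ τ).symm.trans_le (T.obsConst_orliczNorm_le C hΦ τ)
    have le₃ := fun τ (_ : 0 < τ) => (le₁ τ).trans (le_mul_of_one_le_left' one_le_two)
    have hadm : T.IsAdmissibleObs Φ C ↔
        (T.dual hT).IsAdmissibleCtrl (complementaryYoung Φ) C' :=
      ⟨exists_lt_top_of_le_two_mul fun τ _ => le₂ τ, exists_lt_top_of_le_two_mul le₃⟩
    exact ⟨hadm, and_congr hadm
      ⟨iSup_lt_top_of_le_two_mul fun τ _ => le₂ τ, iSup_lt_top_of_le_two_mul le₃⟩,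
      fun τ _ => ⟨e₁ τ, e₂ τ, le₁ τ, le₂ τ⟩,
      iSup_congr fun τ => iSup_congr fun _ => e₁ τ, iSup_congr fun τ => iSup_congr fun _ => e₂ τ⟩
  · have le₁ := fun τ => T.obsConst_dualControl_le hT (B := B) hΦ τ
    have le₂ := fun τ (_ : 0 < τ) => (le₁ τ).trans (le_mul_of_one_le_left' one_le_two)
    refine ⟨exists_lt_top_of_le_two_mul le₂, And.imp (exists_lt_top_of_le_two_mul le₂)
      (iSup_lt_top_of_le_two_mul le₂), fun τ _ => le₁ τ, iSup₂_mono fun τ _ => le₁ τ, fun h => ?_⟩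
    have e₁ := fun τ (hτ : 0 < τ) =>
      T.obsConst_dualControl_orliczNorm_eq hT (B := B) hΦ h hτ
    have e₂ := fun τ (hτ : 0 < τ) =>
      T.obsConst_dualControl_luxemburgNorm_eq hT (B := B) hΦ h hτ
    have le₃ := fun τ (hτ : 0 < τ) => (e₁ τ hτ).symm.trans_le
      ((T.dual hT).obsConst_orliczNorm_le (T.dualControl hT hβ B) hΦ.complementary τ)
    exact ⟨exists_lt_top_of_le_two_mul le₃, And.imp (exists_lt_top_of_le_two_mul le₃)
      (iSup_lt_top_of_le_two_mul le₃), fun τ hτ => ⟨e₁ τ hτ, e₂ τ hτ, le₃ τ hτ⟩,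
      iSup_congr fun τ => iSup_congr fun hτ => e₁ τ hτ,
      iSup_congr fun τ => iSup_congr fun hτ => e₂ τ hτ⟩
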